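/- Let $r\ge 1$, let $(a_0,\dots,a_r)\in\mathbb R^{r+1}$ be nonzero, and let $M$ be a contractible open subset of $\mathbb R^r$ with coordinates $w^0,\dots,w^{r-1}$. Put $w^{i,s}=\partial_x^s w^i$ and let $\mathcal A$ be the completion of $C^\infty(M)[\epsilon w^i_x,\epsilon^2w^i_{xx},\dots]$ with respect to the grading $\deg f(w)=0$, $\deg(\epsilon^s w^{i,s})=s$; its elements are the series $\sum_{d\ge0}\epsilon^d f_d$ with $f_d\in C^\infty(M)[w^{i,s}: s\ge1]$ homogeneous of differential degree $d$. Thus $\mathcal A$ is a subring of $\mathcal E=C^\infty(M)[w^{i,s}: s\ge 1][[\epsilon]]$, on which $\partial_x$ acts as the total derivative. Let $$\hat A=w^0+w^1\lambda+\cdots+w^{r-1}\lambda^{r-1}+\lambda^r,\qquad \hat a=a_0+a_1\lambda+\cdots+a_r\lambda^r .$$ A system $w^i_t=X^i$ $(0\le i<r)$ with $X^i\in\mathcal E$ acts on $\mathcal E$ by the chain rule, $f_t=\sum_{i}\sum_{s\ge0}(\partial_x^sX^i)\,\partial f/\partial w^{i,s}$. Then: 1. There is exactly one series $b=1+b_1\lambda^{-1}+b_2\lambda^{-2}+\cdots$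 with $b_k\in\mathcal A$ such that $\hat A b^2-\frac{\epsilon^2}4\hat a(2bb_{xx}-b_x^2)=\lambda^r$. A series $c=c_0+c_1\lambda+c_2\lambda^2+\cdots$ with $c_k\in\mathcal A$ such that $\hat A c^2-\frac{\epsilon^2}4\hat a(2cc_{xx}-c_x^2)=1$ exists if and only if $w^0>0$ on $M$, and it is then unique up to sign. 2. For $n\in\mathbb Z$ let $B_n=(\lambda^nb)_+$ if $n\ge0$ and $B_n=(\lambda^nc)_-$ if $n<0$, where $(\cdot)_+$ keeps the powers $\lambda^i$ with $i\ge0$ and $(\cdot)_-$ those with $i<0$, and where $c$ (either choice of sign) is assumed to exist whenever a negative index occurs. Then $2\hat A B_{n,x}+\hat A_xB_n-\frac{\epsilon^2}2\hat a B_{n,xxx}$ is a polynomial in $\lambda$ of degree at most $r-1$, so that the compatibility condition $$\hat A_{t_n}=2\hat A B_{n,x}+\hat A_xB_n-\tfrac{\epsilon^2}2\hat a B_{n,xxx}$$ of the linear system $\epsilon^2\phi_{xx}=(\hat A/\hat a)\phi$, $\phi_{t_n}=B_n\phi_x-\frac12B_{n,x}\phi$ is equivalent to an evolutionary system for $w^0,\dots,w^{r-1}$.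 Let $\partial_{t_n}$ be its flow. 3. All these flows commute: for all $n,m\in\mathbb Z$, $[\partial_{t_n},\partial_{t_m}]=0$ on $\mathcal E$, in particular on $\mathcal A$. -/

import Mathlib

open scoped Manifold ContDiff
open TopologicalSpace

namespace RKdVCH

noncomputable section

/-- The ring `C^∞(M)`, where the manifold `M` with its coordinates `w⁰, …, w^{r-1}` is an open
subset of `ℝ^r`. -/
abbrev SmoothFun {r : ℕ} (M : Opens (Fin r → ℝ)) : Type :=
  C^∞⟮𝓘(ℝ, Fin r → ℝ), M; 𝓘(ℝ, ℝ), ℝ⟯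

/-- The coordinate function `wⁱ` on `M`. -/
def coordFun {r : ℕ} (M : Opens (Fin r → ℝ)) (i : Fin r) : SmoothFun M :=
  ⟨fun u => u.1 i, fun u => by
    have h : ContMDiffAt 𝓘(ℝ, Fin r → ℝ) 𝓘(ℝ, ℝ) ∞ (fun x : Fin r → ℝ => x i) u.1 :=
      (contDiff_apply ℝ ℝ i).contMDiff.contMDiffAt
    exact contMDiffAt_subtype_iff.mpr h⟩

/-- A function on `M`, extended by zero to `ℝ^r`. -/
def extZero {r : ℕ} {M : Opens (Fin r → ℝ)} (f : M → ℝ) : (Fin r → ℝ) → ℝ :=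
  Function.extend Subtype.val f 0

theorem extZero_apply {r : ℕ} {M : Opens (Fin r → ℝ)} (f : M → ℝ) (u : M) :
    extZero f u.1 = f u :=
  Subtype.val_injective.extend_apply f 0 u

theorem contDiffAt_extZero {r : ℕ} {M : Opens (Fin r → ℝ)} (f : SmoothFun M) (u : M) :
    ContDiffAt ℝ ∞ (extZero f) u.1 := by
  have h : ContMDiffAt 𝓘(ℝ, Fin r → ℝ) 𝓘(ℝ, ℝ) ∞ (fun x : M => extZero f x.1) u := by
    have e : (fun x : M => extZero f x.1) = f := funext fun x => extZero_apply _ x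
    rw [e]
    exact f.contMDiff u
  exact (contMDiffAt_subtype_iff.mp h).contDiffAt

/-- The partial derivative `∂f/∂wⁱ` of a smooth function on `M`. -/
def partialW {r : ℕ} {M : Opens (Fin r → ℝ)} (i : Fin r) (f : SmoothFun M) : SmoothFun M :=
  ⟨fun u => fderiv ℝ (extZero f) u.1 (Pi.single i 1), fun u => by
    have h : ContDiffAt ℝ ∞ (fun x => fderiv ℝ (extZero f) x (Pi.single i 1)) u.1 :=
      ((contDiffAt_extZero f u).fderiv_right (m := ∞) (by simp)).clm_apply contDiffAt_const
    exact contMDiffAt_subtype_iff.mpr h.contMDiffAt⟩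

/-- Differential polynomials `C^∞(M)[wⁱ_x, wⁱ_xx, …]`; the variable `(i, s)` stands for the jet
variable `w^{i,s+1} = ∂_x^{s+1} wⁱ`. -/
abbrev DiffPoly {r : ℕ} (M : Opens (Fin r → ℝ)) : Type :=
  MvPolynomial (Fin r × ℕ) (SmoothFun M)

/-- `DiffPoly M [[ε]]`, the ring in which all computations take place. -/
abbrev DiffSeries {r : ℕ} (M : Opens (Fin r → ℝ)) : Type :=
  PowerSeries (DiffPoly M)

/-- The formal parameter `ε`. -/
def eps {r : ℕ} (M : Opens (Fin r → ℝ)) : DiffSeries M := PowerSeries.X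

/-- The ring `𝒜`: the completion of `C^∞(M)[ε wⁱ_x, ε² wⁱ_xx, …]` with respect to the grading
`deg f(w) = 0`, `deg (ε^s w^{i,s}) = s`. Its elements are the series `∑ ε^d f_d`, where `f_d` is
a differential polynomial which is homogeneous of degree `d`. -/
def ringA {r : ℕ} (M : Opens (Fin r → ℝ)) : Subring (DiffSeries M) where
  carrier := {f | ∀ d : ℕ, MvPolynomial.IsWeightedHomogeneous (fun v : Fin r × ℕ => v.2 + 1)
    (PowerSeries.coeff d f) d}
  mul_mem' := by
    intro f g hf hg d
    rw [PowerSeries.coeff_mul]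
    refine (MvPolynomial.weightedHomogeneousSubmodule _ _ _).sum_mem ?_
    rintro ⟨p, q⟩ h
    rw [← Finset.HasAntidiagonal.mem_antidiagonal.mp h]
    exact (hf p).mul (hg q)
  one_mem' := by
    intro d
    rw [PowerSeries.coeff_one]
    split_ifs with h
    · subst h
      exact MvPolynomial.isWeightedHomogeneous_one _ _
    · exact MvPolynomial.isWeightedHomogeneous_zero _ _ _
  add_mem' := by
    intro f g hf hg d
    rw [map_add]
    exact (hf d).add (hg d)
  zero_mem' := by
    intro d
    rw [map_zero]
    exact MvPolynomial.isWeightedHomogeneous_zero _ _ _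
  neg_mem' := by
    intro f hf d
    rw [map_neg]
    have h := (MvPolynomial.weightedHomogeneousSubmodule (SmoothFun M)
      (fun v : Fin r × ℕ => v.2 + 1) d).neg_mem (hf d)
    exact h

/-- `∂p/∂wⁱ` for a differential polynomial `p`: the jet variables are kept fixed. -/
def partialCoeff {r : ℕ} {M : Opens (Fin r → ℝ)} (i : Fin r) (p : DiffPoly M) : DiffPoly M :=
  ∑ m ∈ p.support, MvPolynomial.monomial m (partialW i (MvPolynomial.coeff m p))

/-- The total derivative `∂_x p = ∑_i ∑_{s ≥ 0} w^{i,s+1} ∂p/∂w^{i,s}` of a differential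
polynomial. -/
def dxPoly {r : ℕ} {M : Opens (Fin r → ℝ)} (p : DiffPoly M) : DiffPoly M :=
  (∑ i : Fin r, MvPolynomial.X (i, 0) * partialCoeff i p) +
    MvPolynomial.mkDerivation (SmoothFun M)
      (fun v : Fin r × ℕ => (MvPolynomial.X (v.1, v.2 + 1) : DiffPoly M)) p

/-- `∂_x` on series in `ε`. -/
def dx {r : ℕ} {M : Opens (Fin r → ℝ)} (f : DiffSeries M) : DiffSeries M :=
  PowerSeries.mk fun d => dxPoly (PowerSeries.coeff d f)

/-- The chain rule `∑_i ∑_{s ≥ 0} (∂_x^s Xⁱ) ∂p/∂w^{i,s}` for a differential polynomial `p`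
along the evolutionary system `wⁱ_t = Xⁱ`. -/
def evolvePoly {r : ℕ} {M : Opens (Fin r → ℝ)} (X : Fin r → DiffSeries M) (p : DiffPoly M) :
    DiffSeries M :=
  (∑ i : Fin r, X i * PowerSeries.C (partialCoeff i p)) +
    MvPolynomial.mkDerivation (SmoothFun M)
      (fun v : Fin r × ℕ => (dx^[v.2 + 1] (X v.1) : DiffSeries M)) p

/-- The time derivative `f ↦ f_t` along the evolutionary system `wⁱ_t = Xⁱ`, extended from
differential polynomials to series in `ε` by `ε`-linearity:
`(∑ ε^q f_q)_t = ∑ ε^q (f_q)_t`. -/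
def evolve {r : ℕ} {M : Opens (Fin r → ℝ)} (X : Fin r → DiffSeries M) (f : DiffSeries M) :
    DiffSeries M :=
  PowerSeries.mk fun d => ∑ pq ∈ Finset.HasAntidiagonal.antidiagonal d,
    PowerSeries.coeff pq.1 (evolvePoly X (PowerSeries.coeff pq.2 f))

/-- The coefficients `w⁰, …, w^{r-1}, w^r = 1` of `Â`. -/
def wHat {r : ℕ} (M : Opens (Fin r → ℝ)) : Fin (r + 1) → DiffSeries M :=
  Fin.snoc (α := fun _ => DiffSeries M)
    (fun i : Fin r => PowerSeries.C (MvPolynomial.C (coordFun M i))) 1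

/-- The coefficients `a₀, …, a_r` of `â` as elements of `DiffSeries M`. -/
def aHat {r : ℕ} (M : Opens (Fin r → ℝ)) (a : Fin (r + 1) → ℝ) : Fin (r + 1) → DiffSeries M :=
  fun i => algebraMap ℝ (DiffSeries M) (a i)

/-- `∂_x`, coefficient by coefficient, on power series in `λ` or in `λ⁻¹`. -/
def dxSeries {r : ℕ} {M : Opens (Fin r → ℝ)} (y : PowerSeries (DiffSeries M)) :
    PowerSeries (DiffSeries M) :=
  PowerSeries.mk fun k => dx (PowerSeries.coeff k y)

/-- `P y² - (ε²/4) Q (2 y y_xx - y_x²)`. -/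
def quadratic {r : ℕ} {M : Opens (Fin r → ℝ)} (P Q y : PowerSeries (DiffSeries M)) :
    PowerSeries (DiffSeries M) :=
  P * y ^ 2 - PowerSeries.C (algebraMap ℝ (DiffSeries M) (1 / 4) * eps M ^ 2) * Q *
    (2 * y * dxSeries (dxSeries y) - dxSeries y ^ 2)

/-- `b = 1 + b₁ λ⁻¹ + b₂ λ⁻² + ⋯` with `b_k ∈ 𝒜` solves
`Â b² - (ε²/4) â (2 b b_xx - b_x²) = λ^r`. Here `b` is a power series in `λ⁻¹`, and the equation
is multiplied by `λ^{-r}`, so that all its terms are power series in `λ⁻¹`. -/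
def IsSeriesB {r : ℕ} {M : Opens (Fin r → ℝ)} (a : Fin (r + 1) → ℝ)
    (b : PowerSeries (DiffSeries M)) : Prop :=
  PowerSeries.coeff 0 b = 1 ∧ (∀ k, PowerSeries.coeff k b ∈ ringA M) ∧
    quadratic
      (∑ i : Fin (r + 1), PowerSeries.C (wHat M i) * PowerSeries.X ^ (r - (i : ℕ)))
      (∑ i : Fin (r + 1), PowerSeries.C (aHat M a i) * PowerSeries.X ^ (r - (i : ℕ))) b = 1

/-- `c = c₀ + c₁ λ + c₂ λ² + ⋯` with `c_k ∈ 𝒜` solves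
`Â c² - (ε²/4) â (2 c c_xx - c_x²) = 1`. Here `c` is a power series in `λ`. -/
def IsSeriesC {r : ℕ} {M : Opens (Fin r → ℝ)} (a : Fin (r + 1) → ℝ)
    (c : PowerSeries (DiffSeries M)) : Prop :=
  (∀ k, PowerSeries.coeff k c ∈ ringA M) ∧
    quadratic
      (∑ i : Fin (r + 1), PowerSeries.C (wHat M i) * PowerSeries.X ^ (i : ℕ))
      (∑ i : Fin (r + 1), PowerSeries.C (aHat M a i) * PowerSeries.X ^ (i : ℕ)) c = 1

/-- `B_n = (λⁿ b)₊ = ∑_{k ≤ n} b_k λ^{n-k}` for `n ≥ 0`, and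
`B_n = (λⁿ c)₋ = ∑_{k < -n} c_k λ^{n+k}` for `n < 0`. -/
def laxB {r : ℕ} {M : Opens (Fin r → ℝ)} (b c : PowerSeries (DiffSeries M)) :
    ℤ → LaurentPolynomial (DiffSeries M)
  | Int.ofNat n => ∑ k ∈ Finset.range (n + 1),
      LaurentPolynomial.C (PowerSeries.coeff k b) * LaurentPolynomial.T ((n : ℤ) - k)
  | Int.negSucc m => ∑ k ∈ Finset.range (m + 1),
      LaurentPolynomial.C (PowerSeries.coeff k c) * LaurentPolynomial.T ((k : ℤ) - (m + 1))

/-- `∂_x`, coefficient by coefficient, on Laurent polynomials in `λ`. -/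
def dxLaurent {r : ℕ} {M : Opens (Fin r → ℝ)} (B : LaurentPolynomial (DiffSeries M)) :
    LaurentPolynomial (DiffSeries M) :=
  ∑ n ∈ B.coeff.support, LaurentPolynomial.C (dx (B.coeff n)) * LaurentPolynomial.T n

/-- The polynomial `∑ i, y i λⁱ` in `λ`. -/
def lambdaSum {r k : ℕ} {M : Opens (Fin r → ℝ)} (y : Fin k → DiffSeries M) :
    LaurentPolynomial (DiffSeries M) :=
  ∑ i : Fin k, LaurentPolynomial.C (y i) * LaurentPolynomial.T ((i : ℕ) : ℤ)

/-- `2 Â B_x + Â_x B - (ε²/2) â B_xxx`, the right hand side of the compatibility condition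
`Â_t = 2 Â B_x + Â_x B - (ε²/2) â B_xxx` of the linear system `ε² φ_xx = (Â/â) φ`,
`φ_t = B φ_x - (1/2) B_x φ`. -/
def laxRHS {r : ℕ} {M : Opens (Fin r → ℝ)} (a : Fin (r + 1) → ℝ)
    (B : LaurentPolynomial (DiffSeries M)) : LaurentPolynomial (DiffSeries M) :=
  2 * lambdaSum (wHat M) * dxLaurent B + dxLaurent (lambdaSum (wHat M)) * B -
    LaurentPolynomial.C (algebraMap ℝ (DiffSeries M) (1 / 2) * eps M ^ 2) *
      lambdaSum (aHat M a) * dxLaurent (dxLaurent (dxLaurent B))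

/-- The right hand sides `Xⁱ` of the evolutionary system `wⁱ_t = Xⁱ`, `0 ≤ i < r`, given by `B`:
the coefficients of `λⁱ` in the compatibility condition. -/
def flow {r : ℕ} {M : Opens (Fin r → ℝ)} (a : Fin (r + 1) → ℝ)
    (B : LaurentPolynomial (DiffSeries M)) : Fin r → DiffSeries M :=
  fun i => (laxRHS a B).coeff ((i : ℕ) : ℤ)

end

end RKdVCH

namespace RKdVCH

noncomputable section

/-! ### Calculus on jets: evolutionary derivations and their commutators. -/

section Jets

variable {r : ℕ} {M : Opens (Fin r → ℝ)}

/-! Existence and uniqueness of `b` and `c` come from a contraction argument. At total order zero in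
`ε` and `λ^{∓1}` the quadratic equation reduces to `P y² = 1`, which fixes the leading term: 1 for
`b`, a square root of `1/w⁰` for `c`. From there the iteration `quadraticStep` contracts for the
filtration by total degree (`quadraticStep_contraction`), and it stays in `𝒜` because each `∂_x` can
be paired with an `ε`.

For the flows, write `L(B) = 2ÂB_x + Â_xB - (ε²/2)âB_xxx`. The quadratic expression is a first
integral of `L`: its `x`-derivative is `y L(y)` (`laurentDer_quad`), hence `L(λⁿb) = L(λⁿc) = 0`. So
`L(B_n)` is minus `L` of the discarded tail. One description bounds the exponents from below, the
other from above, and only `λ⁰, …, λ^{r-1}` survive (`lambdaSum_flow`).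

If a flow `D` acts on `Â` by `L(B)`, differentiating the quadratic equation gives a homogeneous
linear equation for `Dy - [B, y]`, where `[u, v] = uv_x - u_xv`. It has only the zero solution, by
`ε`-adic separatedness (`flow_sub_bracket_mem`). Thus `b` and `c` evolve by the bracket with `B`.
Cutting these equations at `λ⁰` yields the zero curvature equation `D_nB_m - D_mB_n = [B_n, B_m]`,
since the difference of its two sides is supported on both sides of the cut (`zero_curvature_same`,
`zero_curvature_opposite`). Zero curvature makes the two flows commute on `Â` (`laurentLax_compat`).
The commutator of two flows is again evolutionary, so its vanishing on the coordinates suffices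
(`evolve_comm`).

Infinite series in `λ` and in `λ⁻¹` have no common product, so `b` and `c` are replaced by
truncations in the ring of Laurent polynomials. The errors are measured by `laurentFil R σ J`, with
`σ = 1` for `c` and `σ = -1` for `b`. All equations hold modulo this filtration, whose level grows
with the truncation order. -/

theorem extZero_eventuallyEq {f : M → ℝ} {g : (Fin r → ℝ) → ℝ} (h : ∀ u : M, f u = g u.1) (u : M) :
    extZero f =ᶠ[nhds u.1] g := by
  filter_upwards [M.isOpen.mem_nhds u.2] with x hx
  exact (extZero_apply f ⟨x, hx⟩).trans (h ⟨x, hx⟩)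

theorem partialW_apply (i : Fin r) (f : SmoothFun M) (u : M) :
    partialW i f u = fderiv ℝ (extZero f) u.1 (Pi.single i 1) := rfl

/-- As `M` is open, any function agreeing with `f` on `M` has the same germ at points of `M` as the
extension by zero, so derivatives may be computed from any convenient representative. -/
theorem partialW_apply_of_eq {i : Fin r} {f : SmoothFun M} {g : (Fin r → ℝ) → ℝ}
    (h : ∀ u : M, f u = g u.1) (u : M) :
    partialW i f u = fderiv ℝ g u.1 (Pi.single i 1) := by
  rw [partialW_apply, (extZero_eventuallyEq h u).fderiv_eq]

theorem differentiableAt_extZero (f : SmoothFun M) (u : M) :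
    DifferentiableAt ℝ (extZero f) u.1 :=
  (contDiffAt_extZero f u).differentiableAt (by simp)

theorem partialW_add (i : Fin r) (f g : SmoothFun M) :
    partialW i (f + g) = partialW i f + partialW i g := by
  ext u
  have h : partialW i (f + g) u = fderiv ℝ (extZero f + extZero g) u.1 (Pi.single i 1) :=
    partialW_apply_of_eq (fun v => by simp [extZero_apply]) u
  rw [h, fderiv_add (differentiableAt_extZero f u) (differentiableAt_extZero g u)]
  rfl

theorem partialW_mul (i : Fin r) (f g : SmoothFun M) :
    partialW i (f * g) = f * partialW i g + g * partialW i f := by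
  ext u
  have h : partialW i (f * g) u = fderiv ℝ (extZero f * extZero g) u.1 (Pi.single i 1) :=
    partialW_apply_of_eq (fun v => by simp [extZero_apply]) u
  rw [h, fderiv_mul (differentiableAt_extZero f u) (differentiableAt_extZero g u)]
  simp [extZero_apply, partialW_apply]

theorem partialW_algebraMap (i : Fin r) (c : ℝ) :
    partialW i (algebraMap ℝ (SmoothFun M) c) = 0 := by
  ext u
  have h : partialW i (algebraMap ℝ (SmoothFun M) c) u =
      fderiv ℝ (fun _ => c) u.1 (Pi.single i 1) :=
    partialW_apply_of_eq (fun v => rfl) u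
  rw [h]
  simp

theorem partialW_coordFun (i j : Fin r) :
    partialW i (coordFun M j) = if i = j then 1 else 0 := by
  ext u
  have h : partialW i (coordFun M j) u =
      fderiv ℝ (fun x : Fin r → ℝ => x j) u.1 (Pi.single i 1) :=
    partialW_apply_of_eq (fun v => rfl) u
  have h' : HasFDerivAt (fun x : Fin r → ℝ => x j)
      (ContinuousLinearMap.proj (R := ℝ) (φ := fun _ : Fin r => ℝ) j) u.1 :=
    hasFDerivAt_apply j u.1
  rw [h, h'.fderiv]
  by_cases hij : i = j
  · subst hij; simp
  · simp [hij, Ne.symm hij]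

theorem partialW_comm (i j : Fin r) (f : SmoothFun M) :
    partialW i (partialW j f) = partialW j (partialW i f) := by
  have key : ∀ (i j : Fin r) (u : M), partialW i (partialW j f) u =
      fderiv ℝ (fderiv ℝ (extZero f)) u.1 (Pi.single i 1) (Pi.single j 1) := by
    intro i j u
    have h : partialW i (partialW j f) u =
        fderiv ℝ (fun x => fderiv ℝ (extZero f) x (Pi.single j 1)) u.1 (Pi.single i 1) :=
      partialW_apply_of_eq (fun v => rfl) u
    have hd : DifferentiableAt ℝ (fderiv ℝ (extZero f)) u.1 :=
      ((contDiffAt_extZero f u).fderiv_right (m := ∞) (by simp)).differentiableAt (by simp)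
    rw [h, fderiv_clm_apply hd (differentiableAt_const _)]
    simp
  ext u
  rw [key, key]
  exact (contDiffAt_extZero f u).isSymmSndFDerivAt
    (by
      rw [minSmoothness_of_isRCLikeNormedField]
      exact WithTop.coe_le_coe.mpr (le_top : (2 : ℕ∞) ≤ ⊤)) _ _

/-- The partial derivative `∂/∂wⁱ` as a derivation of `C^∞(M)`. -/
def partialWDer (i : Fin r) : Derivation ℝ (SmoothFun M) (SmoothFun M) where
  toFun := partialW i
  map_add' := partialW_add i
  map_smul' c f := by
    rw [Algebra.smul_def, partialW_mul, partialW_algebraMap]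
    simp [Algebra.smul_def]
  map_one_eq_zero' := by
    have := partialW_algebraMap (M := M) i 1
    rwa [map_one] at this
  leibniz' f g := partialW_mul i f g

@[simp] theorem partialWDer_apply (i : Fin r) (f : SmoothFun M) :
    partialWDer i f = partialW i f := rfl

@[simp] theorem partialW_zero (i : Fin r) : partialW i (0 : SmoothFun M) = 0 :=
  map_zero (partialWDer i)

@[simp] theorem coeff_partialCoeff (i : Fin r) (p : DiffPoly M) (m : Fin r × ℕ →₀ ℕ) :
    MvPolynomial.coeff m (partialCoeff i p) = partialW i (MvPolynomial.coeff m p) := by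
  classical
  rw [partialCoeff, MvPolynomial.coeff_sum]
  simp only [MvPolynomial.coeff_monomial]
  rw [Finset.sum_ite_eq' p.support m]
  split_ifs with h
  · rfl
  · rw [MvPolynomial.notMem_support_iff.mp h, partialW_zero]

theorem partialCoeff_C (i : Fin r) (f : SmoothFun M) :
    partialCoeff i (MvPolynomial.C f) = MvPolynomial.C (partialW i f) := by
  classical
  ext1 m
  rw [coeff_partialCoeff, MvPolynomial.coeff_C, MvPolynomial.coeff_C]
  split_ifs <;> simp

theorem partialCoeff_X (i : Fin r) (v : Fin r × ℕ) :
    partialCoeff i (MvPolynomial.X v : DiffPoly M) = 0 := by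
  classical
  ext1 m
  rw [coeff_partialCoeff, MvPolynomial.coeff_X]
  split_ifs
  · exact (partialWDer i).map_one_eq_zero
  · simp

/-- `∂/∂wⁱ` as a derivation of the differential polynomials. -/
def partialCoeffDer (i : Fin r) : Derivation ℝ (DiffPoly M) (DiffPoly M) where
  toFun := partialCoeff i
  map_add' p q := by
    ext1 m
    simp [partialW_add]
  map_smul' c p := by
    ext1 m
    have h := (partialWDer i).map_smul c (MvPolynomial.coeff m p)
    rw [partialWDer_apply, partialWDer_apply] at h
    rw [coeff_partialCoeff, MvPolynomial.coeff_smul, h, RingHom.id_apply, MvPolynomial.coeff_smul,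
      coeff_partialCoeff]
  map_one_eq_zero' := by
    have h := partialCoeff_C i (1 : SmoothFun M)
    have h1 : partialW i (1 : SmoothFun M) = 0 := (partialWDer i).map_one_eq_zero
    rw [h1, map_one, map_zero] at h
    exact h
  leibniz' p q := by
    classical
    ext1 m
    simp only [smul_eq_mul, MvPolynomial.coeff_add]
    change MvPolynomial.coeff m (partialCoeff i (p * q)) =
      MvPolynomial.coeff m (p * partialCoeff i q) + MvPolynomial.coeff m (q * partialCoeff i p)
    rw [mul_comm q, coeff_partialCoeff, MvPolynomial.coeff_mul, MvPolynomial.coeff_mul,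
      MvPolynomial.coeff_mul, ← partialWDer_apply, map_sum, ← Finset.sum_add_distrib]
    refine Finset.sum_congr rfl fun x _ => ?_
    simp [mul_comm]

theorem diffPoly_smul_eq (p : DiffPoly M) (f : DiffSeries M) :
    p • f = PowerSeries.C p * f :=
  PowerSeries.smul_eq_C_mul f p

/-- `evolvePoly X` as a derivation. -/
def evolvePolyDer (X : Fin r → DiffSeries M) : Derivation ℝ (DiffPoly M) (DiffSeries M) where
  toFun := evolvePoly X
  map_add' p q := by
    have h : ∀ i, partialCoeff i (p + q) = partialCoeff i p + partialCoeff i q :=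
      fun i => (partialCoeffDer i).map_add p q
    simp only [evolvePoly, h, map_add, mul_add, Finset.sum_add_distrib]
    abel
  map_smul' c p := by
    have h : ∀ i, partialCoeff i (c • p) = c • partialCoeff i p :=
      fun i => (partialCoeffDer i).map_smul c p
    have h2 : ∀ q : DiffPoly M, (PowerSeries.C (c • q) : DiffSeries M) = c • PowerSeries.C q :=
      fun q => by
        ext1 n
        change _ = c • PowerSeries.coeff n (PowerSeries.C q)
        rw [PowerSeries.coeff_C, PowerSeries.coeff_C]
        split_ifs <;> simp
    have h3 : c • p = (algebraMap ℝ (SmoothFun M) c) • p := by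
      rw [algebraMap_smul]
    have h4 : ∀ q : DiffSeries M, c • q = (algebraMap ℝ (SmoothFun M) c) • q := fun q => by
      rw [algebraMap_smul]
    simp only [evolvePoly, h, h2, RingHom.id_apply, smul_add, Finset.smul_sum, mul_smul_comm]
    congr 1
    rw [h3, Derivation.map_smul, h4]
  map_one_eq_zero' := by
    have h : ∀ i, partialCoeff i (1 : DiffPoly M) = 0 :=
      fun i => (partialCoeffDer i).map_one_eq_zero
    change evolvePoly X 1 = 0
    simp [evolvePoly, h]
  leibniz' p q := by
    have h : ∀ i, partialCoeff i (p * q) = p * partialCoeff i q + q * partialCoeff i p :=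
      fun i => (partialCoeffDer i).leibniz p q
    change evolvePoly X (p * q) = p • evolvePoly X q + q • evolvePoly X p
    simp only [evolvePoly, h, Derivation.leibniz, diffPoly_smul_eq, mul_add, Finset.mul_sum,
      Finset.sum_add_distrib, map_add, map_mul, mul_left_comm (X _)]
    abel

@[simp] theorem evolvePolyDer_apply (X : Fin r → DiffSeries M) (p : DiffPoly M) :
    evolvePolyDer X p = evolvePoly X p := rfl

/-- The `ε`-linear and `ε`-adically continuous extension to `DiffSeries M` of a map on the
differential polynomials. -/
def extendEps (δ : DiffPoly M → DiffSeries M) (f : DiffSeries M) : DiffSeries M :=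
  PowerSeries.mk fun d => ∑ pq ∈ Finset.HasAntidiagonal.antidiagonal d,
    PowerSeries.coeff pq.1 (δ (PowerSeries.coeff pq.2 f))

theorem coeff_extendEps (δ : DiffPoly M → DiffSeries M) (f : DiffSeries M) (d : ℕ) :
    PowerSeries.coeff d (extendEps δ f) = ∑ pq ∈ Finset.HasAntidiagonal.antidiagonal d,
      PowerSeries.coeff pq.1 (δ (PowerSeries.coeff pq.2 f)) :=
  PowerSeries.coeff_mk _ _

theorem extendEps_mul (δ : Derivation ℝ (DiffPoly M) (DiffSeries M)) (f g : DiffSeries M) :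
    extendEps δ (f * g) = f * extendEps δ g + g * extendEps δ f := by
  have key : ∀ (f g : DiffSeries M) (d : ℕ), PowerSeries.coeff d (f * extendEps δ g) =
      ∑ x ∈ Finset.HasAntidiagonal.antidiagonal d,
        ∑ y ∈ Finset.HasAntidiagonal.antidiagonal x.2,
        PowerSeries.coeff y.1 f * PowerSeries.coeff x.1 (δ (PowerSeries.coeff y.2 g)) := by
    intro f g d
    simp only [PowerSeries.coeff_mul, coeff_extendEps, Finset.mul_sum]
    rw [Finset.sum_sigma', Finset.sum_sigma']
    -- Both sides sum over triples of degrees with total `d`, one each from `f`, from `g` and from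
    -- the value of `δ`. Exchanging the degrees of `f` and of `δ` is an involution, so the same
    -- formula serves in both directions.
    refine Finset.sum_nbij'
      (fun x => ⟨(x.2.1, x.1.1 + x.2.2), (x.1.1, x.2.2)⟩)
      (fun x => ⟨(x.2.1, x.1.1 + x.2.2), (x.1.1, x.2.2)⟩) ?_ ?_ ?_ ?_ ?_ <;>
    simp only [Finset.mem_sigma, Finset.HasAntidiagonal.mem_antidiagonal, and_imp, Sigma.forall,
      Prod.forall] <;>
    intros <;> subst_vars <;> first | rfl | (constructor <;> first | rfl | omega | dsimp only)
  ext1 d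
  rw [map_add, key, mul_comm g, mul_comm (extendEps _ _) g, key, coeff_extendEps,
    ← Finset.sum_add_distrib]
  refine Finset.sum_congr rfl fun x _ => ?_
  rw [PowerSeries.coeff_mul, map_sum, map_sum]
  rw [← Finset.Nat.sum_antidiagonal_swap (f := fun y => PowerSeries.coeff y.1 g *
    PowerSeries.coeff x.1 (δ (PowerSeries.coeff y.2 f))), ← Finset.sum_add_distrib]
  refine Finset.sum_congr rfl fun y _ => ?_
  simp [diffPoly_smul_eq, PowerSeries.coeff_C_mul]

/-- The extension of a derivation of the differential polynomials to `DiffSeries M`. -/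
def extendDer (δ : Derivation ℝ (DiffPoly M) (DiffSeries M)) :
    Derivation ℝ (DiffSeries M) (DiffSeries M) where
  toFun := extendEps δ
  map_add' f g := by
    ext1 d
    simp [coeff_extendEps, Finset.sum_add_distrib]
  map_smul' c f := by
    ext1 d
    have h : ∀ q (g : DiffSeries M), PowerSeries.coeff q (c • g) = c • PowerSeries.coeff q g :=
      fun q g => rfl
    simp [coeff_extendEps, h, Finset.smul_sum]
  map_one_eq_zero' := by
    ext1 d
    change PowerSeries.coeff d (extendEps δ 1) = 0
    rw [coeff_extendEps]
    refine Finset.sum_eq_zero fun x _ => ?_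
    rw [PowerSeries.coeff_one]
    split_ifs <;> simp
  leibniz' f g := extendEps_mul δ f g

theorem coeff_extendDer (δ : Derivation ℝ (DiffPoly M) (DiffSeries M)) (f : DiffSeries M) (d : ℕ) :
    PowerSeries.coeff d (extendDer δ f) = ∑ pq ∈ Finset.HasAntidiagonal.antidiagonal d,
      PowerSeries.coeff pq.1 (δ (PowerSeries.coeff pq.2 f)) :=
  coeff_extendEps _ _ _

theorem extendDer_C (δ : Derivation ℝ (DiffPoly M) (DiffSeries M)) (p : DiffPoly M) :
    extendDer δ (PowerSeries.C p) = δ p := by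
  ext1 d
  rw [coeff_extendDer, Finset.sum_eq_single (d, 0)]
  · simp
  · rintro ⟨x, y⟩ h h'
    have hy : y ≠ 0 := by
      rintro rfl
      simp at h
      exact h' (by rw [h])
    simp [PowerSeries.coeff_C, hy]
  · simp

theorem extendDer_eps (δ : Derivation ℝ (DiffPoly M) (DiffSeries M)) :
    extendDer δ (eps M) = 0 := by
  ext1 d
  rw [coeff_extendDer, map_zero]
  refine Finset.sum_eq_zero fun x _ => ?_
  rw [eps, PowerSeries.coeff_X]
  split_ifs <;> simp

/-- `∂_t` along the evolutionary system `wⁱ_t = Xⁱ`, as a derivation. -/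
def evolveDer (X : Fin r → DiffSeries M) : Derivation ℝ (DiffSeries M) (DiffSeries M) :=
  extendDer (evolvePolyDer X)

theorem evolveDer_apply (X : Fin r → DiffSeries M) (f : DiffSeries M) :
    evolveDer X f = evolve X f := rfl

/-- The total derivative `∂_x` as a derivation of the differential polynomials. -/
def dxPolyDer : Derivation ℝ (DiffPoly M) (DiffPoly M) where
  toFun := dxPoly
  map_add' p q := by
    have h : ∀ i, partialCoeff i (p + q) = partialCoeff i p + partialCoeff i q :=
      fun i => (partialCoeffDer i).map_add p q
    simp only [dxPoly, h, map_add, mul_add, Finset.sum_add_distrib]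
    abel
  map_smul' c p := by
    have h : ∀ i, partialCoeff i (c • p) = c • partialCoeff i p :=
      fun i => (partialCoeffDer i).map_smul c p
    have h4 : ∀ q : DiffPoly M, c • q = (algebraMap ℝ (SmoothFun M) c) • q := fun q => by
      rw [algebraMap_smul]
    simp only [dxPoly, h, RingHom.id_apply, smul_add, Finset.smul_sum, mul_smul_comm]
    congr 1
    rw [h4, Derivation.map_smul, h4]
  map_one_eq_zero' := by
    have h : ∀ i, partialCoeff i (1 : DiffPoly M) = 0 :=
      fun i => (partialCoeffDer i).map_one_eq_zero
    change dxPoly 1 = 0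
    simp [dxPoly, h]
  leibniz' p q := by
    have h : ∀ i, partialCoeff i (p * q) = p * partialCoeff i q + q * partialCoeff i p :=
      fun i => (partialCoeffDer i).leibniz p q
    change dxPoly (p * q) = p • dxPoly q + q • dxPoly p
    simp only [dxPoly, h, Derivation.leibniz, smul_eq_mul, mul_add, Finset.mul_sum,
      Finset.sum_add_distrib, mul_left_comm (MvPolynomial.X _)]
    abel

@[simp] theorem dxPolyDer_apply (p : DiffPoly M) : dxPolyDer p = dxPoly p := rfl

/-- The constant embedding of the differential polynomials, as a linear map over them. -/
def embedC : DiffPoly M →ₗ[DiffPoly M] DiffSeries M :=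
  Algebra.linearMap (DiffPoly M) (DiffSeries M)

theorem embedC_apply (p : DiffPoly M) : embedC p = PowerSeries.C p := rfl

/-- `∂_x` as a derivation of `DiffSeries M`. -/
def dxDer : Derivation ℝ (DiffSeries M) (DiffSeries M) :=
  extendDer (embedC.compDer dxPolyDer)

theorem dxDer_apply (f : DiffSeries M) : dxDer f = dx f := by
  ext1 d
  rw [dxDer, coeff_extendDer, dx, PowerSeries.coeff_mk, Finset.sum_eq_single (0, d)]
  · simp [embedC_apply]
  · rintro ⟨x, y⟩ h h'
    have hx : x ≠ 0 := by
      rintro rfl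
      simp at h
      exact h' (by rw [h])
    simp [embedC_apply, PowerSeries.coeff_C, hx]
  · simp

/-- The jet variable `w^{i,s}` as an element of `DiffSeries M`. -/
def jetVar (M : Opens (Fin r → ℝ)) (i : Fin r) : ℕ → DiffSeries M
  | 0 => PowerSeries.C (MvPolynomial.C (coordFun M i))
  | s + 1 => PowerSeries.C (MvPolynomial.X (i, s))

theorem evolvePoly_C (X : Fin r → DiffSeries M) (f : SmoothFun M) :
    evolvePoly X (MvPolynomial.C f) =
      ∑ i, X i * PowerSeries.C (MvPolynomial.C (partialW i f)) := by
  simp [evolvePoly, partialCoeff_C]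

theorem dxPoly_C (f : SmoothFun M) :
    dxPoly (MvPolynomial.C f) = ∑ i, MvPolynomial.X (i, 0) * MvPolynomial.C (partialW i f) := by
  simp [dxPoly, partialCoeff_C]

theorem evolve_jetVar (X : Fin r → DiffSeries M) (i : Fin r) (s : ℕ) :
    evolve X (jetVar M i s) = dx^[s] (X i) := by
  cases s with
  | zero =>
    rw [jetVar, ← evolveDer_apply, evolveDer, extendDer_C, evolvePolyDer_apply, evolvePoly_C]
    simp [partialW_coordFun]
  | succ s =>
    rw [jetVar, ← evolveDer_apply, evolveDer, extendDer_C, evolvePolyDer_apply]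
    simp [evolvePoly, partialCoeff_X]

theorem dx_C (p : DiffPoly M) : dx (PowerSeries.C p) = PowerSeries.C (dxPoly p) := by
  rw [← dxDer_apply, dxDer, extendDer_C]
  rfl

theorem dx_jetVar (i : Fin r) (s : ℕ) : dx (jetVar M i s) = jetVar M i (s + 1) := by
  cases s with
  | zero =>
    rw [jetVar, dx_C, dxPoly_C, jetVar]
    simp [partialW_coordFun]
  | succ s =>
    rw [jetVar, dx_C, jetVar]
    simp [dxPoly, partialCoeff_X]

/-- A derivation of `DiffSeries M` that is `ε`-linear and satisfies the chain rule on `C^∞(M)`. -/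
structure IsEvolutionary (D : Derivation ℝ (DiffSeries M) (DiffSeries M)) : Prop where
  map_eps : D (eps M) = 0
  chain : ∀ f : SmoothFun M, D (PowerSeries.C (MvPolynomial.C f)) =
    ∑ i, PowerSeries.C (MvPolynomial.C (partialW i f)) * D (jetVar M i 0)

theorem isEvolutionary_evolveDer (X : Fin r → DiffSeries M) : IsEvolutionary (evolveDer X) where
  map_eps := extendDer_eps _
  chain f := by
    have h : ∀ i, evolveDer X (jetVar M i 0) = X i := fun i => evolve_jetVar X i 0
    simp only [h]
    rw [evolveDer, extendDer_C, evolvePolyDer_apply, evolvePoly_C]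
    exact Finset.sum_congr rfl fun i _ => mul_comm _ _

theorem isEvolutionary_dxDer : IsEvolutionary (dxDer (M := M)) where
  map_eps := extendDer_eps _
  chain f := by
    simp only [dxDer_apply, dx_jetVar, dx_C, dxPoly_C, map_sum, map_mul]
    exact Finset.sum_congr rfl fun i _ => mul_comm _ _

/-- The second-order terms `∂_i∂_j f · D₁wⁱ · D₂wʲ` are symmetric because partial derivatives
commute, so they cancel and the chain rule survives. -/
theorem IsEvolutionary.commutator {D₁ D₂ : Derivation ℝ (DiffSeries M) (DiffSeries M)}
    (h₁ : IsEvolutionary D₁) (h₂ : IsEvolutionary D₂) : IsEvolutionary ⁅D₁, D₂⁆ where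
  map_eps := by
    rw [Derivation.commutator_apply, h₁.map_eps, h₂.map_eps, map_zero, map_zero, sub_zero]
  chain f := by
    have key : ∀ {D₁ D₂ : Derivation ℝ (DiffSeries M) (DiffSeries M)}, IsEvolutionary D₁ →
        IsEvolutionary D₂ → D₁ (D₂ (PowerSeries.C (MvPolynomial.C f))) =
        ∑ i, PowerSeries.C (MvPolynomial.C (partialW i f)) * D₁ (D₂ (jetVar M i 0)) +
        ∑ i, ∑ j, PowerSeries.C (MvPolynomial.C (partialW i (partialW j f))) *
          (D₁ (jetVar M i 0) * D₂ (jetVar M j 0)) := by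
      intro D₁ D₂ h₁ h₂
      rw [h₂.chain, map_sum, Finset.sum_comm, ← Finset.sum_add_distrib]
      refine Finset.sum_congr rfl fun i _ => ?_
      rw [Derivation.leibniz, h₁.chain, smul_eq_mul, smul_eq_mul, Finset.mul_sum]
      refine congrArg₂ (· + ·) rfl (Finset.sum_congr rfl fun j _ => ?_)
      rw [mul_comm (D₂ _), mul_assoc]
    rw [Derivation.commutator_apply, key h₁ h₂, key h₂ h₁]
    have hs : ∑ i, ∑ j, PowerSeries.C (MvPolynomial.C (partialW i (partialW j f))) *
          (D₂ (jetVar M i 0) * D₁ (jetVar M j 0)) =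
        ∑ i, ∑ j, PowerSeries.C (MvPolynomial.C (partialW i (partialW j f))) *
          (D₁ (jetVar M i 0) * D₂ (jetVar M j 0)) := by
      rw [Finset.sum_comm]
      refine Finset.sum_congr rfl fun i _ => Finset.sum_congr rfl fun j _ => ?_
      rw [partialW_comm i j f, mul_comm (D₁ _)]
    rw [hs, add_sub_add_right_eq_sub, ← Finset.sum_sub_distrib]
    refine Finset.sum_congr rfl fun i _ => ?_
    rw [Derivation.commutator_apply, mul_sub]

theorem eps_pow_dvd_forall {f : DiffSeries M} (h : ∀ n : ℕ, eps M ^ n ∣ f) : f = 0 := by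
  ext1 d
  rw [PowerSeries.X_pow_dvd_iff.mp (h (d + 1)) d (Nat.lt_succ_self d), map_zero]

/-- No continuity of `D` is assumed. Since `D` kills every differential polynomial, writing `f = f₀
+ εg` gives `Df = ε Dg`; repeating this makes `Df` divisible by every power of `ε`. -/
theorem IsEvolutionary.eq_zero {D : Derivation ℝ (DiffSeries M) (DiffSeries M)}
    (h : IsEvolutionary D) (h0 : ∀ i s, D (jetVar M i s) = 0) : D = 0 := by
  have hC : ∀ p : DiffPoly M, D (PowerSeries.C p) = 0 := by
    intro p
    induction p using MvPolynomial.induction_on with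
    | C f => simp [h.chain, h0]
    | add p q hp hq => rw [map_add, map_add, hp, hq, add_zero]
    | mul_X p v hp =>
      have hv : D (PowerSeries.C (MvPolynomial.X v)) = 0 := h0 v.1 (v.2 + 1)
      rw [map_mul, Derivation.leibniz, hp, hv, smul_zero, smul_zero, add_zero]
  have hn : ∀ (n : ℕ) (f : DiffSeries M), eps M ^ n ∣ D f := by
    intro n
    induction n with
    | zero => intro f; simp
    | succ n ih =>
      intro f
      obtain ⟨g, hg⟩ : ∃ g, f = PowerSeries.C (PowerSeries.constantCoeff f) + eps M * g := by
        obtain ⟨g, hg⟩ : (PowerSeries.X : DiffSeries M) ∣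
            f - PowerSeries.C (PowerSeries.constantCoeff f) :=
          PowerSeries.X_dvd_iff.mpr (by simp)
        exact ⟨g, by rw [eps, ← hg]; ring⟩
      rw [hg, map_add, hC, zero_add, Derivation.leibniz, h.map_eps, smul_zero, add_zero, smul_eq_mul,
        pow_succ']
      exact mul_dvd_mul_left _ (ih g)
  ext1 f
  exact eps_pow_dvd_forall fun n => hn n f

/-- The bracket is evolutionary and kills each `w^{i,s}`: both orders of application give `∂_x^{s+1}
Xⁱ`. -/
theorem evolveDer_dxDer_comm (X : Fin r → DiffSeries M) (f : DiffSeries M) :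
    evolveDer X (dxDer f) = dxDer (evolveDer X f) := by
  have h : ⁅evolveDer X, dxDer (M := M)⁆ = 0 := by
    refine ((isEvolutionary_evolveDer X).commutator isEvolutionary_dxDer).eq_zero fun i s => ?_
    rw [Derivation.commutator_apply, dxDer_apply, dxDer_apply, dx_jetVar, evolveDer_apply,
      evolveDer_apply, evolve_jetVar, evolve_jetVar, Function.iterate_succ_apply', sub_self]
  rw [← sub_eq_zero, ← Derivation.commutator_apply, h]
  rfl

/-- Agreement on the `wⁱ` spreads to all `w^{i,s}` because both flows commute with `∂_x`, and from
there to the whole ring by `IsEvolutionary.eq_zero`. -/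
theorem evolve_comm {X Y : Fin r → DiffSeries M} (hXY : ∀ i, evolve X (Y i) = evolve Y (X i))
    (f : DiffSeries M) : evolve X (evolve Y f) = evolve Y (evolve X f) := by
  have hit : ∀ (X : Fin r → DiffSeries M) (s : ℕ) (g : DiffSeries M),
      evolveDer X (dx^[s] g) = dx^[s] (evolveDer X g) := by
    intro X s g
    induction s with
    | zero => rfl
    | succ s ih =>
      rw [Function.iterate_succ_apply', Function.iterate_succ_apply', ← ih, ← dxDer_apply,
        ← dxDer_apply, evolveDer_dxDer_comm]
  have h : ⁅evolveDer X, evolveDer Y⁆ = 0 := by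
    refine ((isEvolutionary_evolveDer X).commutator
      (isEvolutionary_evolveDer Y)).eq_zero fun i s => ?_
    rw [Derivation.commutator_apply, evolveDer_apply Y (jetVar M i s),
      evolveDer_apply X (jetVar M i s), evolve_jetVar, evolve_jetVar, hit, hit, evolveDer_apply,
      evolveDer_apply, hXY, sub_self]
  rw [← evolveDer_apply, ← evolveDer_apply, ← evolveDer_apply, ← evolveDer_apply, ← sub_eq_zero,
    ← Derivation.commutator_apply, h]
  rfl

end Jets

/-! ### Laurent polynomials filtered by order at `λ = 0` or at `λ = ∞`. -/

section Laurent

open LaurentPolynomial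

variable {R : Type*} [CommRing R]

/-- The Laurent polynomials all of whose exponents `n` satisfy `J ≤ σ * n`. -/
def laurentFil (R : Type*) [CommRing R] (σ J : ℤ) : Submodule R R[T;T⁻¹] where
  carrier := {f | ∀ n, σ * n < J → f.coeff n = 0}
  add_mem' hf hg n hn := by
    rw [AddMonoidAlgebra.coeff_add, Finsupp.add_apply, hf n hn, hg n hn, add_zero]
  zero_mem' n _ := rfl
  smul_mem' c f hf n hn := by
    rw [AddMonoidAlgebra.coeff_smul_apply, hf n hn, smul_zero]

theorem laurentFil_mono {σ J K : ℤ} (h : J ≤ K) {f : R[T;T⁻¹]} (hf : f ∈ laurentFil R σ K) :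
    f ∈ laurentFil R σ J :=
  fun n hn => hf n (hn.trans_le h)

theorem mul_mem_laurentFil {σ J K : ℤ} {f g : R[T;T⁻¹]} (hf : f ∈ laurentFil R σ J)
    (hg : g ∈ laurentFil R σ K) : f * g ∈ laurentFil R σ (J + K) := by
  intro n hn
  rw [AddMonoidAlgebra.coeff_mul]
  refine Finset.sum_eq_zero fun a _ => Finset.sum_eq_zero fun b _ => ?_
  dsimp only
  split_ifs with h
  · by_cases ha : σ * a < J
    · rw [hf a ha, zero_mul]
    · have hb : σ * b < K := by
        have : σ * n = σ * a + σ * b := by rw [← h, mul_add]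
        omega
      rw [hg b hb, mul_zero]
  · rfl

theorem mul_mem_laurentFil_right {σ K : ℤ} {f g : R[T;T⁻¹]} (hf : f ∈ laurentFil R σ 0)
    (hg : g ∈ laurentFil R σ K) : f * g ∈ laurentFil R σ K := by
  simpa using mul_mem_laurentFil hf hg

theorem T_mul_mem_laurentFil {σ J n : ℤ} {f : R[T;T⁻¹]} (hf : f ∈ laurentFil R σ J) :
    T n * f ∈ laurentFil R σ (J + σ * n) := by
  intro k hk
  have h : (T n * f).coeff k = f.coeff (k - n) := by
    have := AddMonoidAlgebra.coeff_single_mul_add f (1 : R) n (k - n)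
    rw [add_sub_cancel, one_mul] at this
    exact this
  rw [h]
  exact hf _ (by rw [mul_sub]; omega)

theorem C_mul_mem_laurentFil {σ J : ℤ} (a : R) {f : R[T;T⁻¹]} (hf : f ∈ laurentFil R σ J) :
    C a * f ∈ laurentFil R σ J := by
  rw [← smul_eq_C_mul]
  exact (laurentFil R σ J).smul_mem a hf

theorem C_mem_laurentFil (σ : ℤ) (a : R) : C a ∈ laurentFil R σ 0 := by
  intro n hn
  rw [C_apply, if_neg]
  rintro rfl
  simp at hn

theorem C_mul_T_mem_laurentFil {σ J n : ℤ} (a : R) (h : J ≤ σ * n) :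
    C a * T n ∈ laurentFil R σ J := by
  rw [mul_comm]
  exact laurentFil_mono (by simpa using h) (T_mul_mem_laurentFil (C_mem_laurentFil σ a))

/-- An exponent `n` in the support would satisfy `J ≤ σn ≤ -K`. This is how every exact identity is
recovered from two one-sided congruences. -/
theorem eq_zero_of_mem_laurentFil {σ J K : ℤ} (hJK : 0 < J + K) {f : R[T;T⁻¹]}
    (h₁ : f ∈ laurentFil R σ J) (h₂ : f ∈ laurentFil R (-σ) K) : f = 0 := by
  ext n
  by_cases h : σ * n < J
  · exact h₁ n h
  · exact h₂ n (by rw [neg_mul]; omega)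

variable [Algebra ℝ R]

/-- A derivation of the coefficients, applied to Laurent polynomials coefficient by coefficient. -/
def laurentDer (D : Derivation ℝ R R) : Derivation ℝ R[T;T⁻¹] R[T;T⁻¹] :=
  have hadd : ∀ f g : R[T;T⁻¹],
      (AddMonoidAlgebra.ofCoeff ((f + g).coeff.mapRange D (map_zero D)) : R[T;T⁻¹]) =
        .ofCoeff (f.coeff.mapRange D (map_zero D)) + .ofCoeff (g.coeff.mapRange D (map_zero D)) :=
    fun f g => by ext n; simp
  Derivation.mk'
    { toFun := fun f => .ofCoeff (f.coeff.mapRange D (map_zero D))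
      map_add' := hadd
      map_smul' := fun c f => by ext n; simp }
    (by
      intro f g
      simp only [LinearMap.coe_mk, AddHom.coe_mk, smul_eq_mul]
      have hC : ∀ (n : ℤ) (a : R), (AddMonoidAlgebra.ofCoeff
          ((C a * T n : R[T;T⁻¹]).coeff.mapRange D (map_zero D)) : R[T;T⁻¹]) = C (D a) * T n := by
        intro n a
        rw [← single_eq_C_mul_T, ← single_eq_C_mul_T, AddMonoidAlgebra.coeff_single,
          Finsupp.mapRange_single, AddMonoidAlgebra.ofCoeff_single]
      induction f using LaurentPolynomial.induction_on' with
      | add p q hp hq => rw [add_mul, hadd, hadd, hp, hq]; ring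
      | C_mul_T n a =>
        induction g using LaurentPolynomial.induction_on' with
        | add p q hp hq => rw [mul_add, hadd, hadd, hp, hq]; ring
        | C_mul_T m b =>
          have h : (C a * T n * (C b * T m) : R[T;T⁻¹]) = C (a * b) * T (n + m) := by
            rw [map_mul, T_add]; ring
          rw [h, hC, hC, hC, D.leibniz, map_add, smul_eq_mul, smul_eq_mul, map_mul, map_mul, T_add]
          ring)

@[simp] theorem coeff_laurentDer (D : Derivation ℝ R R) (f : R[T;T⁻¹]) (n : ℤ) :
    (laurentDer D f).coeff n = D (f.coeff n) := rfl

theorem laurentDer_C_mul_T (D : Derivation ℝ R R) (a : R) (n : ℤ) :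
    laurentDer D (C a * T n) = C (D a) * T n := by
  ext k
  rw [coeff_laurentDer, ← single_eq_C_mul_T, ← single_eq_C_mul_T]
  simp only [AddMonoidAlgebra.coeff_single, Finsupp.single_apply]
  split_ifs <;> simp

@[simp] theorem laurentDer_C (D : Derivation ℝ R R) (a : R) :
    laurentDer D (C a) = C (D a) := by
  have h := laurentDer_C_mul_T D a 0
  rwa [T_zero, mul_one, mul_one] at h

@[simp] theorem laurentDer_T (D : Derivation ℝ R R) (n : ℤ) : laurentDer D (T n) = 0 := by
  have h := laurentDer_C_mul_T D 1 n
  rwa [D.map_one_eq_zero, map_zero, zero_mul, map_one, one_mul] at h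

theorem laurentDer_T_mul (D : Derivation ℝ R R) (n : ℤ) (f : R[T;T⁻¹]) :
    laurentDer D (T n * f) = T n * laurentDer D f := by
  rw [Derivation.leibniz, laurentDer_T]
  simp

theorem laurentDer_comm {D D' : Derivation ℝ R R} (h : ∀ x, D (D' x) = D' (D x))
    (f : R[T;T⁻¹]) : laurentDer D (laurentDer D' f) = laurentDer D' (laurentDer D f) := by
  ext n
  simp [h]

theorem laurentDer_mem {σ J : ℤ} (D : Derivation ℝ R R) {f : R[T;T⁻¹]}
    (hf : f ∈ laurentFil R σ J) : laurentDer D f ∈ laurentFil R σ J := by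
  intro n hn
  rw [coeff_laurentDer, hf n hn, map_zero]

theorem mem_laurentFil_of_two_mul {σ J : ℤ} {f : R[T;T⁻¹]} (h : 2 * f ∈ laurentFil R σ J) :
    f ∈ laurentFil R σ J := by
  have h2 : f = C (algebraMap ℝ R (1 / 2)) * (2 * f) := by
    have : C (algebraMap ℝ R (1 / 2)) * 2 = (1 : R[T;T⁻¹]) := by
      rw [← map_ofNat (C : R →+* R[T;T⁻¹]) 2, ← map_mul, ← map_ofNat (algebraMap ℝ R) 2,
        ← map_mul]
      norm_num
    rw [← mul_assoc, this, one_mul]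
  rw [h2]
  exact C_mul_mem_laurentFil _ h

/-- A congruence `u ≡ e Φ u` modulo the filtration can be iterated; if `R` is `e`-adically
separated, it forces `u` into the filtration. -/
theorem mem_laurentFil_of_contraction {σ J : ℤ} {e : R}
    (he : ∀ x : R, (∀ N : ℕ, e ^ N ∣ x) → x = 0) {u : R[T;T⁻¹]} (Φ : R[T;T⁻¹] →ₗ[ℝ] R[T;T⁻¹])
    (hΦe : ∀ x, Φ (C e * x) = C e * Φ x)
    (hΦ : ∀ x ∈ laurentFil R σ J, Φ x ∈ laurentFil R σ J)
    (hu : u - C e * Φ u ∈ laurentFil R σ J) : u ∈ laurentFil R σ J := by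
  have hpow : ∀ (N : ℕ) (x : R[T;T⁻¹]), Φ (C e ^ N * x) = C e ^ N * Φ x := by
    intro N x
    induction N with
    | zero => simp
    | succ N ih => rw [pow_succ', mul_assoc, hΦe, ih, mul_assoc]
  have key : ∀ N : ℕ, ∃ v, u - C e ^ N * v ∈ laurentFil R σ J := by
    intro N
    induction N with
    | zero => exact ⟨u, by simp⟩
    | succ N ih =>
      obtain ⟨v, hv⟩ := ih
      refine ⟨Φ v, ?_⟩
      have h1 := add_mem hu (C_mul_mem_laurentFil e (hΦ _ hv))
      rw [map_sub, hpow] at h1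
      convert h1 using 1
      ring
  intro n hn
  refine he _ fun N => ?_
  obtain ⟨v, hv⟩ := key N
  refine ⟨v.coeff n, ?_⟩
  have h := hv n hn
  rw [AddMonoidAlgebra.coeff_sub, Finsupp.sub_apply, sub_eq_zero] at h
  rw [h, ← map_pow, ← smul_eq_C_mul, AddMonoidAlgebra.coeff_smul_apply, smul_eq_mul]

/-! ### The quadratic form, the Lax operator, and zero curvature. -/

/-- `A y² - (e²/4) a (2 y y'' - y'²)` for Laurent polynomials. -/
def laurentQuad (d : Derivation ℝ R R) (e : R) (A a y : R[T;T⁻¹]) : R[T;T⁻¹] :=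
  A * y ^ 2 - C (algebraMap ℝ R (1 / 4) * e ^ 2) * a *
    (2 * y * laurentDer d (laurentDer d y) - laurentDer d y ^ 2)

/-- `2 A B' + A' B - (e²/2) a B'''` for Laurent polynomials. -/
def laurentLax (d : Derivation ℝ R R) (e : R) (A a B : R[T;T⁻¹]) : R[T;T⁻¹] :=
  2 * A * laurentDer d B + laurentDer d A * B - C (algebraMap ℝ R (1 / 2) * e ^ 2) * a *
    laurentDer d (laurentDer d (laurentDer d B))

/-- The Lie bracket `u v' - u' v` of vector fields. -/
def laurentBracket (d : Derivation ℝ R R) (u v : R[T;T⁻¹]) : R[T;T⁻¹] :=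
  u * laurentDer d v - laurentDer d u * v

theorem C_half_eq (e : R) : (C (algebraMap ℝ R (1 / 2) * e ^ 2) : R[T;T⁻¹]) =
    2 * C (algebraMap ℝ R (1 / 4) * e ^ 2) := by
  rw [← map_ofNat (C : R →+* R[T;T⁻¹]) 2, ← map_mul, ← map_ofNat (algebraMap ℝ R) 2,
    ← mul_assoc, ← map_mul]
  norm_num

theorem laurentDer_C_quarter {D : Derivation ℝ R R} {e : R} (h : D e = 0) (c : ℝ) :
    laurentDer D (C (algebraMap ℝ R c * e ^ 2)) = 0 := by
  rw [laurentDer_C, Derivation.leibniz, D.map_algebraMap, Derivation.leibniz_pow, h]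
  simp

theorem laurentBracket_mem {σ J K : ℤ} (d : Derivation ℝ R R) {u v : R[T;T⁻¹]}
    (hu : u ∈ laurentFil R σ J) (hv : v ∈ laurentFil R σ K) :
    laurentBracket d u v ∈ laurentFil R σ (J + K) :=
  sub_mem (mul_mem_laurentFil hu (laurentDer_mem d hv))
    (mul_mem_laurentFil (laurentDer_mem d hu) hv)

theorem laurentLax_mem {σ J K : ℤ} (d : Derivation ℝ R R) (e : R) {A a B : R[T;T⁻¹]}
    (hA : A ∈ laurentFil R σ J) (ha : a ∈ laurentFil R σ J) (hB : B ∈ laurentFil R σ K) :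
    laurentLax d e A a B ∈ laurentFil R σ (J + K) := by
  have h2 : (2 * A : R[T;T⁻¹]) ∈ laurentFil R σ J := by rw [two_mul]; exact add_mem hA hA
  exact sub_mem (add_mem (mul_mem_laurentFil h2 (laurentDer_mem d hB))
    (mul_mem_laurentFil (laurentDer_mem d hA) hB))
    (mul_mem_laurentFil (C_mul_mem_laurentFil _ ha)
      (laurentDer_mem d (laurentDer_mem d (laurentDer_mem d hB))))

theorem laurentLax_sub (d : Derivation ℝ R R) (e : R) (A a B B' : R[T;T⁻¹]) :
    laurentLax d e A a (B - B') = laurentLax d e A a B - laurentLax d e A a B' := by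
  simp only [laurentLax, map_sub]
  ring

theorem laurentLax_T (d : Derivation ℝ R R) (e : R) (A a B : R[T;T⁻¹]) (s n : ℤ) :
    laurentLax d e (T s * A) (T s * a) (T n * B) = T (s + n) * laurentLax d e A a B := by
  simp only [laurentLax, laurentDer_T_mul, T_add]
  ring

variable {d D : Derivation ℝ R R} {e : R} {A a y B : R[T;T⁻¹]}

/-- The third-order linear operator has the quadratic expression as a first integral, so a solution
of the quadratic equation lies in its kernel once the factor `y` is removed. -/
theorem laurentDer_quad (hd : d e = 0) (ha : laurentDer d a = 0) :
    laurentDer d (laurentQuad d e A a y) = y * laurentLax d e A a y := by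
  simp only [laurentQuad, laurentLax, map_sub, Derivation.leibniz, Derivation.leibniz_pow,
    laurentDer_C_quarter hd, ha, smul_eq_mul, C_half_eq, nsmul_eq_mul]
  have h2 : laurentDer d (2 : R[T;T⁻¹]) = 0 := by
    exact_mod_cast (laurentDer d).map_natCast 2
  rw [h2]
  push_cast
  ring

/-- The derivative of the quadratic expression along a flow which acts on `A` by the Lax
equation. -/
theorem laurentDer_quad_flow (hD : D e = 0) (hd : d e = 0) (hcomm : ∀ x, D (d x) = d (D x))
    (ha : laurentDer d a = 0) (ha' : laurentDer D a = 0)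
    (hA : laurentDer D A = laurentLax d e A a B) {β : R[T;T⁻¹]}
    (hβ : laurentDer D y = laurentBracket d B y + β) :
    laurentDer D (laurentQuad d e A a y) = B * laurentDer d (laurentQuad d e A a y) +
      2 * (A * y * β - C (algebraMap ℝ R (1 / 4) * e ^ 2) * a *
        (β * laurentDer d (laurentDer d y) + y * laurentDer d (laurentDer d β) -
          laurentDer d y * laurentDer d β)) := by
  have h2 : ∀ D : Derivation ℝ R R, laurentDer D (2 : R[T;T⁻¹]) = 0 := fun D => by
    exact_mod_cast (laurentDer D).map_natCast 2
  rw [laurentDer_quad hd ha]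
  simp only [laurentQuad, map_sub, Derivation.leibniz, Derivation.leibniz_pow,
    laurentDer_C_quarter hD, ha', smul_eq_mul, nsmul_eq_mul, laurentDer_comm hcomm, hβ, h2]
  simp only [hA, laurentLax, laurentBracket, C_half_eq, map_add, map_sub, Derivation.leibniz,
    smul_eq_mul]
  push_cast
  ring

/-- Modulo the filtration, a solution of the quadratic equation solves its linearization. -/
theorem laurentLax_mem_of_quad {σ K : ℤ} (he : ∀ x : R, (∀ N : ℕ, e ^ N ∣ x) → x = 0)
    (hd : d e = 0) (ha : laurentDer d a = 0) (hA0 : A ∈ laurentFil R σ 0)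
    (ha0 : a ∈ laurentFil R σ 0) (hy0 : y ∈ laurentFil R σ 0)
    (hQ : laurentQuad d e A a y - 1 ∈ laurentFil R σ K) :
    laurentLax d e A a y ∈ laurentFil R σ K := by
  set u := laurentLax d e A a y with hu
  have hu0 : u ∈ laurentFil R σ 0 := by simpa using laurentLax_mem d e hA0 ha0 hy0
  -- With this `c` the quadratic expression is `Q = A y² + e c`. The truncation `y` need not be
  -- invertible, so `y u = dQ` is multiplied by `A y` and `u (Q - 1)` is subtracted. What remains is
  -- `u - e c u`, to which the contraction lemma applies.
  set c := -(C (algebraMap ℝ R (1 / 4) * e)) * (a *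
    (2 * y * laurentDer d (laurentDer d y) - laurentDer d y ^ 2)) with hc
  have hy1 := laurentDer_mem d hy0
  have hy2 := laurentDer_mem d hy1
  have hc0 : c ∈ laurentFil R σ 0 := by
    rw [hc, neg_mul]
    refine neg_mem (C_mul_mem_laurentFil _ (mul_mem_laurentFil_right ha0 (sub_mem ?_ ?_)))
    · rw [mul_assoc, two_mul]
      exact add_mem (mul_mem_laurentFil_right hy0 hy2) (mul_mem_laurentFil_right hy0 hy2)
    · rw [sq]
      exact mul_mem_laurentFil_right hy1 hy1
  refine mem_laurentFil_of_contraction he (LinearMap.mulLeft ℝ c) (fun x => ?_) (fun x hx => ?_) ?_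
  · simp only [LinearMap.mulLeft_apply]; ring
  · exact mul_mem_laurentFil_right hc0 hx
  · have h1 : y * u ∈ laurentFil R σ K := by
      rw [hu, ← laurentDer_quad hd ha]
      have := laurentDer_mem d hQ
      rwa [map_sub, Derivation.map_one_eq_zero, sub_zero] at this
    have h2 := sub_mem (mul_mem_laurentFil_right (mul_mem_laurentFil_right hA0 hy0) h1)
      (mul_mem_laurentFil_right hu0 hQ)
    convert h2 using 1
    simp only [LinearMap.mulLeft_apply, hc, laurentQuad, map_mul, map_pow]
    ring

/-- A flow that acts on `A` by the Lax equation acts on a solution of the quadratic equation by the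
Lie bracket, modulo the filtration. -/
theorem flow_sub_bracket_mem {σ K m : ℤ} (he : ∀ x : R, (∀ N : ℕ, e ^ N ∣ x) → x = 0)
    (hD : D e = 0) (hd : d e = 0) (hcomm : ∀ x, D (d x) = d (D x))
    (ha : laurentDer d a = 0) (ha' : laurentDer D a = 0)
    (ha0 : a ∈ laurentFil R σ 0) (hy0 : y ∈ laurentFil R σ 0)
    (hQ : laurentQuad d e A a y - 1 ∈ laurentFil R σ K)
    (hA : laurentDer D A = laurentLax d e A a B) (hm : 0 ≤ m) (hB : B ∈ laurentFil R σ (-m)) :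
    laurentDer D y - laurentBracket d B y ∈ laurentFil R σ (K - m) := by
  obtain ⟨β, hβ⟩ : ∃ β, laurentDer D y = laurentBracket d B y + β :=
    ⟨laurentDer D y - laurentBracket d B y, by ring⟩
  have hflow := laurentDer_quad_flow hD hd hcomm ha ha' hA hβ
  rw [hβ, add_sub_cancel_left]
  have hy1 := laurentDer_mem d hy0
  have hy2 := laurentDer_mem d hy1
  -- A crude a priori bound: it is needed to place `β (Q - 1)` at level `K - m`.
  have hβ0 : β ∈ laurentFil R σ (-m) := by
    have h := sub_mem (laurentFil_mono (by omega) (laurentDer_mem D hy0))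
      (laurentBracket_mem d hB hy0)
    rwa [hβ, add_sub_cancel_left, add_zero] at h
  -- `Φ` is chosen so that `y` times the linearized equation for `β`, minus `β (Q - 1)`, equals `β -
  -- e Φ(β)`. It involves derivatives of `β`, which is why the contraction lemma allows a general
  -- linear map commuting with `e`.
  let Φ : R[T;T⁻¹] →ₗ[ℝ] R[T;T⁻¹] := LinearMap.mulLeft ℝ (-(C (algebraMap ℝ R (1 / 4) * e) * a)) ∘ₗ
    (LinearMap.mulLeft ℝ (y * laurentDer d (laurentDer d y) - laurentDer d y * laurentDer d y) -
      LinearMap.mulLeft ℝ (y * y) ∘ₗ (laurentDer d).toLinearMap ∘ₗ (laurentDer d).toLinearMap +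
      LinearMap.mulLeft ℝ (y * laurentDer d y) ∘ₗ (laurentDer d).toLinearMap)
  have hΦ : ∀ x, Φ x = -(C (algebraMap ℝ R (1 / 4) * e) * a) *
      ((y * laurentDer d (laurentDer d y) - laurentDer d y * laurentDer d y) * x -
        y * y * laurentDer d (laurentDer d x) + y * laurentDer d y * laurentDer d x) :=
    fun x => rfl
  refine mem_laurentFil_of_contraction he Φ (fun x => ?_) (fun x hx => ?_) ?_
  · simp only [hΦ, Derivation.leibniz, laurentDer_C, hd, map_zero, smul_eq_mul, mul_zero, add_zero]
    ring
  · have hx1 := laurentDer_mem d hx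
    rw [hΦ, neg_mul]
    exact neg_mem (mul_mem_laurentFil_right (C_mul_mem_laurentFil _ ha0) (add_mem (sub_mem
      (mul_mem_laurentFil_right (sub_mem (mul_mem_laurentFil_right hy0 hy2)
        (mul_mem_laurentFil_right hy1 hy1)) hx)
      (mul_mem_laurentFil_right (mul_mem_laurentFil_right hy0 hy0) (laurentDer_mem d hx1)))
      (mul_mem_laurentFil_right (mul_mem_laurentFil_right hy0 hy1) hx1)))
  · have h1 : laurentDer D (laurentQuad d e A a y) - B * laurentDer d (laurentQuad d e A a y) ∈
        laurentFil R σ (K - m) := by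
      have hD1 := laurentDer_mem D hQ
      have hd1 := laurentDer_mem d hQ
      rw [map_sub, Derivation.map_one_eq_zero, sub_zero] at hD1 hd1
      refine sub_mem (laurentFil_mono (by omega) hD1) ?_
      exact laurentFil_mono (by omega) (mul_mem_laurentFil hB hd1)
    rw [hflow, add_sub_cancel_left] at h1
    have h2 := sub_mem (mul_mem_laurentFil_right hy0 (mem_laurentFil_of_two_mul h1))
      (laurentFil_mono (by omega) (mul_mem_laurentFil hβ0 hQ) : _ ∈ laurentFil R σ (K - m))
    convert h2 using 1
    simp only [hΦ, laurentQuad, map_mul, map_pow]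
    ring

/-- The zero curvature equation for two flows given by truncations of the same solution. -/
theorem zero_curvature_same {D₁ D₂ : Derivation ℝ R R} {σ J n₁ n₂ : ℤ} {B₁ B₂ : R[T;T⁻¹]}
    (hJ0 : 0 ≤ J) (hJ1 : J ≤ 1)
    (hN₁ : T n₁ * y - B₁ ∈ laurentFil R σ J) (hN₂ : T n₂ * y - B₂ ∈ laurentFil R σ J)
    (hB₁ : B₁ ∈ laurentFil R (-σ) (1 - J)) (hB₂ : B₂ ∈ laurentFil R (-σ) (1 - J))
    (h₁₂ : laurentDer D₁ (T n₂ * y) - laurentBracket d B₁ (T n₂ * y) ∈ laurentFil R σ J)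
    (h₂₁ : laurentDer D₂ (T n₁ * y) - laurentBracket d B₂ (T n₁ * y) ∈ laurentFil R σ J) :
    laurentDer D₁ B₂ - laurentDer D₂ B₁ = laurentBracket d B₁ B₂ := by
  rw [← sub_eq_zero]
  refine eq_zero_of_mem_laurentFil (J := J) (K := 1 - J) (σ := σ) (by omega) ?_ ?_
  · have hz : laurentBracket d (T n₁ * y) (T n₂ * y) = 0 := by
      simp only [laurentBracket, laurentDer_T_mul]
      ring
    have h := sub_mem (add_mem (sub_mem (sub_mem h₁₂ h₂₁) (laurentDer_mem D₁ hN₂))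
      (laurentDer_mem D₂ hN₁)) (laurentFil_mono (by omega) (laurentBracket_mem d hN₁ hN₂))
    convert h using 1
    have hz' : laurentBracket d (T n₁ * y - B₁) (T n₂ * y - B₂) =
        laurentBracket d (T n₁ * y - B₁) (T n₂ * y - B₂) -
          laurentBracket d (T n₁ * y) (T n₂ * y) := by rw [hz, sub_zero]
    rw [hz']
    simp only [laurentBracket, map_sub]
    ring
  · refine sub_mem (sub_mem (laurentDer_mem _ hB₂) (laurentDer_mem _ hB₁)) ?_
    exact laurentFil_mono (by omega) (laurentBracket_mem d hB₁ hB₂)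

/-- The zero curvature equation for two flows given by truncations on opposite sides. -/
theorem zero_curvature_opposite {D₁ D₂ : Derivation ℝ R R} {β₁ β₂ B₁ B₂ : R[T;T⁻¹]}
    (hN₁ : β₁ - B₁ ∈ laurentFil R (-1) 1) (hN₂ : β₂ - B₂ ∈ laurentFil R 1 0)
    (hB₁ : B₁ ∈ laurentFil R 1 0) (hB₂ : B₂ ∈ laurentFil R (-1) 1)
    (h₁₂ : laurentDer D₁ β₂ - laurentBracket d B₁ β₂ ∈ laurentFil R 1 0)
    (h₂₁ : laurentDer D₂ β₁ - laurentBracket d B₂ β₁ ∈ laurentFil R (-1) 1) :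
    laurentDer D₁ B₂ - laurentDer D₂ B₁ = laurentBracket d B₁ B₂ := by
  -- Here the two full series lie on opposite sides and are never bracketed with each other.
  -- Replacing `β₂` by `B₂` costs only tail terms, and bracketing the tail with `B₁` keeps
  -- nonnegative exponents.
  have h1 : laurentDer D₁ B₂ - laurentBracket d B₁ B₂ ∈ laurentFil R 1 0 := by
    have h := add_mem (sub_mem h₁₂ (laurentDer_mem D₁ hN₂)) (laurentBracket_mem d hB₁ hN₂)
    convert h using 1
    simp only [laurentBracket, map_sub]
    ring
  have h2 : laurentDer D₂ B₁ + laurentBracket d B₁ B₂ ∈ laurentFil R (-1) 1 := by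
    have h := add_mem (sub_mem h₂₁ (laurentDer_mem D₂ hN₁))
      (laurentFil_mono (by omega) (laurentBracket_mem d hB₂ hN₁))
    convert h using 1
    simp only [laurentBracket, map_sub]
    ring
  rw [← sub_eq_zero]
  refine eq_zero_of_mem_laurentFil (J := 0) (K := 1) (σ := 1) (by omega) ?_ ?_
  · have h := sub_mem h1 (laurentDer_mem D₂ hB₁)
    convert h using 1
    ring
  · have h := sub_mem (laurentDer_mem D₁ hB₂) h2
    convert h using 1
    ring

/-- The zero curvature equation implies the compatibility of the flows of `A`. -/
theorem laurentLax_compat {D₁ D₂ : Derivation ℝ R R} {B₁ B₂ : R[T;T⁻¹]}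
    (hD₁ : D₁ e = 0) (hD₂ : D₂ e = 0) (hd : d e = 0)
    (hcomm₁ : ∀ x, D₁ (d x) = d (D₁ x)) (hcomm₂ : ∀ x, D₂ (d x) = d (D₂ x))
    (ha : laurentDer d a = 0) (ha₁ : laurentDer D₁ a = 0) (ha₂ : laurentDer D₂ a = 0)
    (hA₁ : laurentDer D₁ A = laurentLax d e A a B₁) (hA₂ : laurentDer D₂ A = laurentLax d e A a B₂)
    (hzc : laurentDer D₁ B₂ - laurentDer D₂ B₁ = laurentBracket d B₁ B₂) :
    laurentDer D₁ (laurentLax d e A a B₂) = laurentDer D₂ (laurentLax d e A a B₁) := by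
  have h2 : ∀ D : Derivation ℝ R R, laurentDer D (2 : R[T;T⁻¹]) = 0 := fun D => by
    exact_mod_cast (laurentDer D).map_natCast 2
  have hzc' : laurentDer D₁ B₂ = laurentDer D₂ B₁ + laurentBracket d B₁ B₂ := by
    rw [← hzc]; ring
  have hl : ∀ B, laurentLax d e A a B = 2 * A * laurentDer d B + laurentDer d A * B -
      2 * C (algebraMap ℝ R (1 / 4) * e ^ 2) * a *
    laurentDer d (laurentDer d (laurentDer d B)) := fun B => by rw [laurentLax, C_half_eq]
  rw [hl B₁] at hA₁
  rw [hl B₂] at hA₂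
  rw [hl, hl]
  simp only [map_sub, map_add, Derivation.leibniz, laurentDer_C_quarter hD₁,
    laurentDer_C_quarter hD₂, ha₁, ha₂, h2, smul_eq_mul, laurentDer_comm hcomm₁,
    laurentDer_comm hcomm₂, hzc']
  -- After zero curvature has replaced `D₁B₂`, the terms in `D₂B₁` cancel. The remaining identity
  -- says that `B` acts on `A` through the Lax operator as a Lie algebra of vector fields.
  simp only [hA₁, hA₂, laurentBracket, map_sub, map_add, Derivation.leibniz,
    laurentDer_C_quarter hd, ha, h2, smul_eq_mul]
  ring

end Laurent

/-! ### Truncated power series as Laurent polynomials. -/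

section Truncation

open LaurentPolynomial

variable {R : Type*} [CommRing R]

/-- The truncation `∑_{k < K} f_k T^{σ k}` of a power series, as a Laurent polynomial. -/
def laurentTrunc (σ : ℤ) (K : ℕ) (f : PowerSeries R) : R[T;T⁻¹] :=
  ∑ k ∈ Finset.range K, C (PowerSeries.coeff k f) * T (σ * k)

/-- The substitution of `T^σ` into polynomials. -/
def laurentSubst (R : Type*) [CommRing R] (σ : ℤ) : Polynomial R →+* R[T;T⁻¹] :=
  Polynomial.eval₂RingHom C (T σ)

theorem laurentSubst_trunc (σ : ℤ) (K : ℕ) (f : PowerSeries R) :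
    laurentSubst R σ (PowerSeries.trunc K f) = laurentTrunc σ K f := by
  induction K with
  | zero => simp [laurentTrunc]
  | succ K ih =>
    rw [PowerSeries.trunc_succ, map_add, ih, laurentTrunc, laurentTrunc, Finset.sum_range_succ]
    simp [laurentSubst, T_pow, mul_comm σ]

theorem laurentTrunc_mem {σ : ℤ} (hσ : σ * σ = 1) (K : ℕ) (f : PowerSeries R) :
    laurentTrunc σ K f ∈ laurentFil R σ 0 :=
  sum_mem fun k _ => C_mul_T_mem_laurentFil _ (by rw [← mul_assoc, hσ]; omega)

theorem laurentTrunc_sub_mem {σ : ℤ} (hσ : σ * σ = 1) {K L : ℕ} (h : K ≤ L) (f : PowerSeries R) :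
    laurentTrunc σ L f - laurentTrunc σ K f ∈ laurentFil R σ K := by
  rw [laurentTrunc, laurentTrunc, ← Finset.sum_sdiff (Finset.range_mono h), add_sub_cancel_right]
  refine sum_mem fun k hk => C_mul_T_mem_laurentFil _ ?_
  rw [← mul_assoc, hσ]
  simp at hk
  omega

theorem laurentSubst_mem {σ : ℤ} (hσ : σ * σ = 1) {K : ℕ} {p : Polynomial R}
    (h : Polynomial.X ^ K ∣ p) : laurentSubst R σ p ∈ laurentFil R σ K := by
  obtain ⟨q, rfl⟩ := h
  have hq : laurentSubst R σ q ∈ laurentFil R σ 0 := by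
    have h := laurentSubst_trunc σ (q.natDegree + 1) (q : PowerSeries R)
    rw [PowerSeries.trunc_coe_eq_self (Nat.lt_succ_self _)] at h
    rw [h]
    exact laurentTrunc_mem hσ _ _
  have hX : laurentSubst R σ (Polynomial.X ^ K) = T (K * σ) := by
    simp [laurentSubst, T_pow]
  rw [map_mul, hX]
  refine laurentFil_mono ?_ (T_mul_mem_laurentFil hq)
  rw [mul_left_comm, hσ]
  simp

/-- A Laurent polynomial agrees with a power series in `T^σ` up to the order `K`. -/
def LaurentApprox (σ : ℤ) (K : ℕ) (f : PowerSeries R) (u : R[T;T⁻¹]) : Prop :=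
  u - laurentTrunc σ K f ∈ laurentFil R σ K

namespace LaurentApprox

variable {σ : ℤ} {K : ℕ} {f g : PowerSeries R} {u v : R[T;T⁻¹]}

theorem trunc (σ : ℤ) (K : ℕ) (f : PowerSeries R) : LaurentApprox σ K f (laurentTrunc σ K f) := by
  rw [LaurentApprox, sub_self]
  exact zero_mem _

theorem add (hu : LaurentApprox σ K f u) (hv : LaurentApprox σ K g v) :
    LaurentApprox σ K (f + g) (u + v) := by
  have h := add_mem hu hv
  rw [LaurentApprox]
  convert h using 1
  simp only [← laurentSubst_trunc, map_add]
  ring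

theorem sub (hu : LaurentApprox σ K f u) (hv : LaurentApprox σ K g v) :
    LaurentApprox σ K (f - g) (u - v) := by
  have h := sub_mem hu hv
  rw [LaurentApprox]
  convert h using 1
  simp only [← laurentSubst_trunc, map_sub]
  ring

theorem mem (hσ : σ * σ = 1) (hu : LaurentApprox σ K f u) : u ∈ laurentFil R σ 0 := by
  have h := add_mem (laurentFil_mono (Int.natCast_nonneg K) hu) (laurentTrunc_mem hσ K f)
  rwa [sub_add_cancel] at h

theorem mul (hσ : σ * σ = 1) (hu : LaurentApprox σ K f u) (hv : LaurentApprox σ K g v) :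
    LaurentApprox σ K (f * g) (u * v) := by
  -- Truncation is multiplicative only up to order `K`; the discrepancy is divisible by `X^K`, which
  -- the substitution sends into level `K`.
  have hd : Polynomial.X ^ K ∣ PowerSeries.trunc K f * PowerSeries.trunc K g -
      PowerSeries.trunc K (f * g) := by
    rw [Polynomial.X_pow_dvd_iff]
    intro d hd
    have h := PowerSeries.trunc_trunc_mul_trunc (n := K) f g
    rw [← Polynomial.coe_mul] at h
    have h' := congrArg (fun p : Polynomial R => p.coeff d) h
    simp only [PowerSeries.coeff_trunc, if_pos hd, Polynomial.coeff_coe] at h'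
    rw [Polynomial.coeff_sub, h', PowerSeries.coeff_trunc, if_pos hd, sub_self]
  have h := add_mem (add_mem (mul_mem_laurentFil_right (hv.mem hσ) hu)
    (mul_mem_laurentFil_right (laurentTrunc_mem hσ K f) hv)) (laurentSubst_mem hσ hd)
  rw [LaurentApprox]
  convert h using 1
  simp only [← laurentSubst_trunc, map_sub, map_mul]
  ring

theorem coe (hσ : σ * σ = 1) (K : ℕ) (p : Polynomial R) :
    LaurentApprox σ K (p : PowerSeries R) (laurentSubst R σ p) := by
  rw [LaurentApprox, ← laurentSubst_trunc, ← map_sub]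
  refine laurentSubst_mem hσ ?_
  rw [Polynomial.X_pow_dvd_iff]
  intro d hd
  rw [Polynomial.coeff_sub, PowerSeries.coeff_trunc, if_pos hd, Polynomial.coeff_coe, sub_self]

theorem const (hσ : σ * σ = 1) (K : ℕ) (a : R) :
    LaurentApprox σ K (PowerSeries.C a) (C a) := by
  have h := coe hσ K (Polynomial.C a)
  rwa [Polynomial.coe_C, laurentSubst, Polynomial.coe_eval₂RingHom, Polynomial.eval₂_C] at h

theorem X_pow (hσ : σ * σ = 1) (K n : ℕ) :
    LaurentApprox σ K (PowerSeries.X ^ n : PowerSeries R) (T (σ * n)) := by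
  have h := coe hσ K (Polynomial.X ^ n : Polynomial R)
  rwa [Polynomial.coe_pow, Polynomial.coe_X, laurentSubst, Polynomial.coe_eval₂RingHom,
    Polynomial.eval₂_X_pow, T_pow, mul_comm] at h

theorem sum {ι : Type*} {s : Finset ι} {f : ι → PowerSeries R} {u : ι → R[T;T⁻¹]}
    (h : ∀ i ∈ s, LaurentApprox σ K (f i) (u i)) :
    LaurentApprox σ K (∑ i ∈ s, f i) (∑ i ∈ s, u i) := by
  have h' := sum_mem h
  rw [LaurentApprox]
  convert h' using 1
  simp only [← laurentSubst_trunc, Finset.sum_sub_distrib]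
  rw [← map_sum]
  congr 2
  ext d
  simp [PowerSeries.coeff_trunc]

theorem der [Algebra ℝ R] (D : Derivation ℝ R R) (hu : LaurentApprox σ K f u) :
    LaurentApprox σ K (PowerSeries.mk fun k => D (PowerSeries.coeff k f)) (laurentDer D u) := by
  have h := laurentDer_mem D hu
  rw [LaurentApprox]
  convert h using 1
  simp [laurentTrunc, map_sum]

end LaurentApprox

theorem exists_mem_laurentFil {σ : ℤ} (hσ : σ * σ = 1) (f : R[T;T⁻¹]) :
    ∃ m : ℕ, f ∈ laurentFil R σ (-(m : ℤ)) := by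
  have hσ' : σ = 1 ∨ σ = -1 := mul_self_eq_one_iff.mp hσ
  induction f using LaurentPolynomial.induction_on' with
  | add p q hp hq =>
    obtain ⟨m, hm⟩ := hp
    obtain ⟨n, hn⟩ := hq
    exact ⟨m + n, add_mem (laurentFil_mono (by push_cast; omega) hm)
      (laurentFil_mono (by push_cast; omega) hn)⟩
  | C_mul_T n a =>
    refine ⟨n.natAbs, C_mul_T_mem_laurentFil a ?_⟩
    rcases hσ' with rfl | rfl <;> omega

end Truncation

/-! ### The flows of the hierarchy, their zero curvature equations and commutation. -/

section Flows

open LaurentPolynomial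

variable {r : ℕ} {M : Opens (Fin r → ℝ)}

theorem dxLaurent_eq (B : LaurentPolynomial (DiffSeries M)) :
    dxLaurent B = laurentDer dxDer B := by
  refine LaurentPolynomial.ext fun n => ?_
  rw [coeff_laurentDer, dxDer_apply, dxLaurent, AddMonoidAlgebra.coeff_sum,
    Finsupp.finsetSum_apply]
  simp only [← single_eq_C_mul_T, AddMonoidAlgebra.coeff_single, Finsupp.single_apply]
  rw [Finset.sum_ite_eq' B.coeff.support n]
  split_ifs with h
  · rfl
  · rw [Finsupp.notMem_support_iff.mp h, ← dxDer_apply, map_zero]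

theorem laxRHS_eq (a : Fin (r + 1) → ℝ) (B : LaurentPolynomial (DiffSeries M)) :
    laxRHS a B = laurentLax dxDer (eps M) (lambdaSum (wHat M)) (lambdaSum (aHat M a)) B := by
  simp only [laxRHS, laurentLax, dxLaurent_eq]

theorem coeff_lambdaSum {k : ℕ} (y : Fin k → DiffSeries M) (j : ℤ) :
    (lambdaSum y).coeff j = ∑ i : Fin k, if ((i : ℕ) : ℤ) = j then y i else 0 := by
  rw [lambdaSum, AddMonoidAlgebra.coeff_sum, Finsupp.finsetSum_apply]
  refine Finset.sum_congr rfl fun i _ => ?_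
  rw [← single_eq_C_mul_T, AddMonoidAlgebra.coeff_single, Finsupp.single_apply]

/-- The two memberships confine the exponents to `0, …, r - 1`, so no term is lost when only those
coefficients are read off. -/
theorem lambdaSum_coeff_eq {f : LaurentPolynomial (DiffSeries M)}
    (h₁ : f ∈ laurentFil _ 1 0) (h₂ : f ∈ laurentFil _ (-1) (1 - r)) :
    lambdaSum (fun i : Fin r => f.coeff ((i : ℕ) : ℤ)) = f := by
  refine LaurentPolynomial.ext fun j => ?_
  rw [coeff_lambdaSum]
  by_cases h : 0 ≤ j ∧ j < r
  · lift j to ℕ using h.1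
    have hj : j < r := by omega
    rw [Finset.sum_eq_single (⟨j, hj⟩ : Fin r)]
    · simp
    · intro i _ hi
      rw [if_neg]
      intro h'
      exact hi (Fin.ext (by simpa using h'))
    · simp
  · rw [Finset.sum_eq_zero]
    · symm
      by_cases h0 : 0 ≤ j
      · exact h₂ j (by omega)
      · exact h₁ j (by omega)
    · intro i _
      rw [if_neg]
      have := i.2
      omega

theorem lambdaSum_mem {k : ℕ} (y : Fin k → DiffSeries M) :
    lambdaSum y ∈ laurentFil _ 1 0 :=
  sum_mem fun i _ => C_mul_T_mem_laurentFil _ (by omega)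

theorem lambdaSum_mem_neg (y : Fin (r + 1) → DiffSeries M) :
    lambdaSum y ∈ laurentFil _ (-1) (-(r : ℤ)) :=
  sum_mem fun i _ => C_mul_T_mem_laurentFil _ (by have := i.2; omega)

theorem laurentDer_lambdaSum {k : ℕ} (D : Derivation ℝ (DiffSeries M) (DiffSeries M))
    (y : Fin k → DiffSeries M) : laurentDer D (lambdaSum y) = lambdaSum fun i => D (y i) := by
  simp only [lambdaSum, map_sum, laurentDer_C_mul_T]

theorem laurentDer_aHat (D : Derivation ℝ (DiffSeries M) (DiffSeries M)) (a : Fin (r + 1) → ℝ) :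
    laurentDer D (lambdaSum (aHat M a)) = 0 := by
  simp [aHat, lambdaSum]

theorem evolveDer_lambdaSum_wHat (X : Fin r → DiffSeries M) :
    laurentDer (evolveDer X) (lambdaSum (wHat M)) = lambdaSum X := by
  rw [laurentDer_lambdaSum, lambdaSum, lambdaSum, Fin.sum_univ_castSucc]
  have h : ∀ i : Fin r, evolveDer X (wHat M i.castSucc) = X i := fun i => by
    rw [wHat, Fin.snoc_castSucc]
    exact evolve_jetVar X i 0
  have h' : evolveDer X (wHat M (Fin.last r)) = 0 := by
    rw [wHat, Fin.snoc_last, Derivation.map_one_eq_zero]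
  simp [h, h']

/-- The truncations of the power series `f` in `λ^σ` solve the quadratic equation, multiplied by
`λ^s`, up to their order. -/
structure IsHalf (a : Fin (r + 1) → ℝ) (σ s : ℤ) (f : PowerSeries (DiffSeries M)) : Prop where
  sq : σ * σ = 1
  memA : T s * lambdaSum (wHat M) ∈ laurentFil (DiffSeries M) σ 0
  mema : T s * lambdaSum (aHat M a) ∈ laurentFil (DiffSeries M) σ 0
  quad : ∀ K : ℕ, laurentQuad dxDer (eps M) (T s * lambdaSum (wHat M)) (T s * lambdaSum (aHat M a))
    (laurentTrunc σ K f) - 1 ∈ laurentFil (DiffSeries M) σ K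

theorem LaurentApprox.quadratic {σ : ℤ} (hσ : σ * σ = 1) {K : ℕ}
    {P Q y : PowerSeries (DiffSeries M)} {A a u : LaurentPolynomial (DiffSeries M)}
    (hP : LaurentApprox σ K P A) (hQ : LaurentApprox σ K Q a) (hy : LaurentApprox σ K y u) :
    LaurentApprox σ K (RKdVCH.quadratic P Q y) (laurentQuad dxDer (eps M) A a u) := by
  have hd : ∀ {y : PowerSeries (DiffSeries M)} {u}, LaurentApprox σ K y u →
      LaurentApprox σ K (dxSeries y) (laurentDer dxDer u) := by
    intro y u hy
    have h := hy.der dxDer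
    simpa only [dxDer_apply, dxSeries] using h
  rw [RKdVCH.quadratic, laurentQuad, pow_two y, pow_two u, two_mul y, two_mul u,
    pow_two (dxSeries y), pow_two (laurentDer dxDer u)]
  exact (hP.mul hσ (hy.mul hσ hy)).sub (((LaurentApprox.const hσ K _).mul hσ hQ).mul hσ
    (((hy.add hy).mul hσ (hd (hd hy))).sub ((hd hy).mul hσ (hd hy))))

theorem laurentQuad_sub_one_mem {σ : ℤ} (hσ : σ * σ = 1) {K : ℕ}
    {P Q y : PowerSeries (DiffSeries M)} {A a : LaurentPolynomial (DiffSeries M)}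
    (hP : LaurentApprox σ K P A) (hQ : LaurentApprox σ K Q a) (hy : quadratic P Q y = 1) :
    laurentQuad dxDer (eps M) A a (laurentTrunc σ K y) - 1 ∈ laurentFil _ σ K := by
  have h := LaurentApprox.quadratic hσ hP hQ (LaurentApprox.trunc σ K y)
  rw [hy] at h
  have h1 : LaurentApprox σ K (1 : PowerSeries (DiffSeries M)) 1 := by
    simpa using LaurentApprox.const hσ K (1 : DiffSeries M)
  have h2 := sub_mem h h1
  rwa [sub_sub_sub_cancel_right] at h2

theorem IsSeriesC.isHalf {a : Fin (r + 1) → ℝ} {c : PowerSeries (DiffSeries M)}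
    (h : IsSeriesC a c) : IsHalf a 1 0 c where
  sq := by norm_num
  memA := by simpa using lambdaSum_mem (wHat M)
  mema := by simpa using lambdaSum_mem (aHat M a)
  quad K := by
    have key : ∀ y : Fin (r + 1) → DiffSeries M, LaurentApprox 1 K
        (∑ i : Fin (r + 1), PowerSeries.C (y i) * PowerSeries.X ^ (i : ℕ)) (lambdaSum y) := by
      intro y
      refine LaurentApprox.sum fun i _ => ?_
      have hX := LaurentApprox.X_pow (R := DiffSeries M) (σ := 1) (by norm_num) K i
      rw [one_mul] at hX
      exact (LaurentApprox.const (by norm_num) K (y i)).mul (by norm_num) hX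
    rw [T_zero, one_mul, one_mul]
    exact laurentQuad_sub_one_mem (by norm_num) (key _) (key _) h.2

theorem IsSeriesB.isHalf {a : Fin (r + 1) → ℝ} {b : PowerSeries (DiffSeries M)}
    (h : IsSeriesB a b) : IsHalf a (-1) (-r) b where
  sq := by norm_num
  memA := by simpa using T_mul_mem_laurentFil (n := -r) (lambdaSum_mem_neg (wHat M))
  mema := by simpa using T_mul_mem_laurentFil (n := -r) (lambdaSum_mem_neg (aHat M a))
  quad K := by
    have key : ∀ y : Fin (r + 1) → DiffSeries M, LaurentApprox (-1) K
        (∑ i : Fin (r + 1), PowerSeries.C (y i) * PowerSeries.X ^ (r - (i : ℕ)))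
          (T (-r) * lambdaSum y) := by
      intro y
      rw [lambdaSum, Finset.mul_sum]
      refine LaurentApprox.sum fun i _ => ?_
      have hX := LaurentApprox.X_pow (R := DiffSeries M) (σ := -1) (by norm_num) K (r - i)
      have hi : (-1 : ℤ) * ((r - (i : ℕ) : ℕ) : ℤ) = -r + (i : ℕ) := by
        have := i.2
        omega
      rw [hi, T_add] at hX
      have h := (LaurentApprox.const (by norm_num) K (y i)).mul (by norm_num) hX
      rwa [mul_left_comm] at h
    exact laurentQuad_sub_one_mem (by norm_num) (key _) (key _) h.2.2

variable {a : Fin (r + 1) → ℝ} {σ s : ℤ} {f : PowerSeries (DiffSeries M)}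

theorem laurentDer_T_mul_aHat (D : Derivation ℝ (DiffSeries M) (DiffSeries M)) (s : ℤ) :
    laurentDer D (T s * lambdaSum (aHat M a)) = 0 := by
  rw [laurentDer_T_mul, laurentDer_aHat, mul_zero]

/-- The truncated form of `L(λⁿ f) = 0`. The factor `λ^{n-s}` shifts the level by `σ(n - s)`, and
`K₀` compensates for that shift. -/
theorem IsHalf.lax_mem (h : IsHalf a σ s f) (n J : ℤ) :
    ∃ K₀ : ℕ, ∀ K : ℕ, K₀ ≤ K →
      laxRHS a (T n * laurentTrunc σ K f) ∈ laurentFil (DiffSeries M) σ J := by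
  refine ⟨(J - σ * (n - s)).toNat, fun K hK => ?_⟩
  have h1 := laurentLax_mem_of_quad (fun x => eps_pow_dvd_forall) isEvolutionary_dxDer.map_eps
    (laurentDer_T_mul_aHat dxDer s) h.memA h.mema (laurentTrunc_mem h.sq K f) (h.quad K)
  have h2 := laurentLax_T dxDer (eps M) (T s * lambdaSum (wHat M)) (T s * lambdaSum (aHat M a))
    (laurentTrunc σ K f) (-s) n
  rw [← mul_assoc, ← mul_assoc, ← T_add, neg_add_cancel, T_zero, one_mul, one_mul] at h2
  rw [laxRHS_eq, h2]
  refine laurentFil_mono ?_ (T_mul_mem_laurentFil h1)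
  rw [neg_add_eq_sub]
  omega

/-- Any flow given by any `B` moves either of `b` and `c` by the bracket; `B` need not come from the
same series. The bound `K₀` absorbs the loss `m` caused by the exponents of `B` and the shift by
`λⁿ`. -/
theorem IsHalf.bracket_mem (h : IsHalf a σ s f) {X : Fin r → DiffSeries M}
    {B : LaurentPolynomial (DiffSeries M)} (hX : lambdaSum X = laxRHS a B) (n J : ℤ) :
    ∃ K₀ : ℕ, ∀ K : ℕ, K₀ ≤ K →
      laurentDer (evolveDer X) (T n * laurentTrunc σ K f) -
        laurentBracket dxDer B (T n * laurentTrunc σ K f) ∈ laurentFil (DiffSeries M) σ J := by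
  obtain ⟨m, hm⟩ := exists_mem_laurentFil h.sq B
  refine ⟨(J + m - σ * n).toNat, fun K hK => ?_⟩
  have hA : laurentDer (evolveDer X) (T s * lambdaSum (wHat M)) =
      laurentLax dxDer (eps M) (T s * lambdaSum (wHat M)) (T s * lambdaSum (aHat M a)) B := by
    have h2 := laurentLax_T dxDer (eps M) (lambdaSum (wHat M)) (lambdaSum (aHat M a)) B s 0
    rw [T_zero, one_mul, add_zero] at h2
    rw [h2, laurentDer_T_mul, evolveDer_lambdaSum_wHat, hX, laxRHS_eq]
  have h1 := flow_sub_bracket_mem (fun x => eps_pow_dvd_forall)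
    (isEvolutionary_evolveDer X).map_eps isEvolutionary_dxDer.map_eps (evolveDer_dxDer_comm X)
    (laurentDer_T_mul_aHat dxDer s) (laurentDer_T_mul_aHat (evolveDer X) s) h.mema
    (laurentTrunc_mem h.sq K f) (h.quad K) hA (Int.natCast_nonneg m) hm
  have h2 := T_mul_mem_laurentFil (n := n) h1
  have h3 : laurentDer (evolveDer X) (T n * laurentTrunc σ K f) -
      laurentBracket dxDer B (T n * laurentTrunc σ K f) =
      T n * (laurentDer (evolveDer X) (laurentTrunc σ K f) -
        laurentBracket dxDer B (laurentTrunc σ K f)) := by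
    simp only [laurentBracket, laurentDer_T_mul]
    ring
  rw [h3]
  exact laurentFil_mono (by omega) h2

theorem laxB_ofNat (b c : PowerSeries (DiffSeries M)) (n : ℕ) :
    laxB b c n = T n * laurentTrunc (-1) (n + 1) b := by
  rw [laurentTrunc, Finset.mul_sum]
  refine Finset.sum_congr rfl fun k _ => ?_
  rw [sub_eq_add_neg, T_add, neg_one_mul]
  ring

theorem laxB_negSucc (b c : PowerSeries (DiffSeries M)) (m : ℕ) :
    laxB b c (Int.negSucc m) = T (Int.negSucc m) * laurentTrunc 1 (m + 1) c := by
  rw [laurentTrunc, Finset.mul_sum]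
  refine Finset.sum_congr rfl fun k _ => ?_
  rw [sub_eq_add_neg, T_add, one_mul, Int.negSucc_eq]
  ring

theorem laxB_ofNat_mem (b c : PowerSeries (DiffSeries M)) (n : ℕ) :
    laxB b c n ∈ laurentFil (DiffSeries M) 1 0 :=
  sum_mem fun k hk => C_mul_T_mem_laurentFil _ (by
    have := Finset.mem_range.mp hk
    omega)

theorem laxB_negSucc_mem (b c : PowerSeries (DiffSeries M)) (m : ℕ) :
    laxB b c (Int.negSucc m) ∈ laurentFil (DiffSeries M) (-1) 1 :=
  sum_mem fun k hk => C_mul_T_mem_laurentFil _ (by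
    have := Finset.mem_range.mp hk
    omega)

theorem sub_laxB_ofNat_mem (b c : PowerSeries (DiffSeries M)) (n : ℕ) {K : ℕ} (hK : n + 1 ≤ K) :
    T n * laurentTrunc (-1) K b - laxB b c n ∈ laurentFil (DiffSeries M) (-1) 1 := by
  rw [laxB_ofNat, ← mul_sub]
  refine laurentFil_mono ?_ (T_mul_mem_laurentFil (laurentTrunc_sub_mem (by norm_num) hK b))
  push_cast
  omega

theorem sub_laxB_negSucc_mem (b c : PowerSeries (DiffSeries M)) (m : ℕ) {K : ℕ}
    (hK : m + 1 ≤ K) :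
    T (Int.negSucc m) * laurentTrunc 1 K c - laxB b c (Int.negSucc m) ∈
      laurentFil (DiffSeries M) 1 0 := by
  rw [laxB_negSucc, ← mul_sub]
  refine laurentFil_mono ?_ (T_mul_mem_laurentFil (laurentTrunc_sub_mem (by norm_num) hK c))
  push_cast
  omega

theorem laxRHS_sub (a : Fin (r + 1) → ℝ) (B B' : LaurentPolynomial (DiffSeries M)) :
    laxRHS a (B - B') = laxRHS a B - laxRHS a B' := by
  rw [laxRHS_eq, laxRHS_eq, laxRHS_eq, laurentLax_sub]

theorem laxRHS_mem (a : Fin (r + 1) → ℝ) {B : LaurentPolynomial (DiffSeries M)} {K : ℤ}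
    (hB : B ∈ laurentFil _ 1 K) : laxRHS a B ∈ laurentFil _ 1 K := by
  rw [laxRHS_eq]
  simpa using laurentLax_mem dxDer (eps M) (lambdaSum_mem _) (lambdaSum_mem _) hB

theorem laxRHS_mem_neg (a : Fin (r + 1) → ℝ) {B : LaurentPolynomial (DiffSeries M)} {K : ℤ}
    (hB : B ∈ laurentFil _ (-1) K) : laxRHS a B ∈ laurentFil _ (-1) (-r + K) := by
  rw [laxRHS_eq]
  exact laurentLax_mem dxDer (eps M) (lambdaSum_mem_neg _) (lambdaSum_mem_neg _) hB

/-- The compatibility condition amounts to an evolutionary system. -/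
theorem lambdaSum_flow {b c : PowerSeries (DiffSeries M)} (hb : IsSeriesB a b) (n : ℤ)
    (hc : n < 0 → IsSeriesC a c) :
    lambdaSum (flow a (laxB b c n)) = laxRHS a (laxB b c n) := by
  -- One bound comes from the exponents of `B_n` itself. The other comes from the tail: `L` of the
  -- full truncation lies in the required filtration level, so `L(B_n)` obeys the same bound as `L`
  -- of the discarded part.
  suffices h : laxRHS a (laxB b c n) ∈ laurentFil _ 1 0 ∧
      laxRHS a (laxB b c n) ∈ laurentFil _ (-1) (1 - r) from lambdaSum_coeff_eq h.1 h.2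
  cases n with
  | ofNat n =>
    refine ⟨laxRHS_mem a (laxB_ofNat_mem b c n), ?_⟩
    obtain ⟨K₀, hK₀⟩ := hb.isHalf.lax_mem n (1 - r)
    have h1 := hK₀ (K₀ + (n + 1)) (by omega)
    have h2 := laxRHS_mem_neg a (sub_laxB_ofNat_mem b c n (K := K₀ + (n + 1)) (by omega))
    rw [laxRHS_sub] at h2
    have h3 := sub_mem h1 (laurentFil_mono (by omega) h2)
    rwa [sub_sub_cancel] at h3
  | negSucc m =>
    refine ⟨?_, laurentFil_mono (by omega) (laxRHS_mem_neg a (laxB_negSucc_mem b c m))⟩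
    obtain ⟨K₀, hK₀⟩ := (hc (Int.negSucc_lt_zero m)).isHalf.lax_mem (Int.negSucc m) 0
    have h1 := hK₀ (K₀ + (m + 1)) (by omega)
    have h2 := laxRHS_mem a (sub_laxB_negSucc_mem b c m (K := K₀ + (m + 1)) (by omega))
    rw [laxRHS_sub] at h2
    have h3 := sub_mem h1 h2
    rwa [sub_sub_cancel] at h3

/-- Indices of equal sign use one series and vanishing of the bracket of its multiples; indices of
opposite sign use `b` and `c` together. The order (negative, nonnegative) follows from the reverse
order by antisymmetry. Truncation orders need only exceed the thresholds of the estimates. -/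
theorem zero_curvature {b c : PowerSeries (DiffSeries M)} (hb : IsSeriesB a b) (n m : ℤ)
    (hc : n < 0 ∨ m < 0 → IsSeriesC a c) :
    laurentDer (evolveDer (flow a (laxB b c n))) (laxB b c m) -
      laurentDer (evolveDer (flow a (laxB b c m))) (laxB b c n) =
      laurentBracket dxDer (laxB b c n) (laxB b c m) := by
  have opp : ∀ n m : ℕ, IsSeriesC a c →
      laurentDer (evolveDer (flow a (laxB b c n))) (laxB b c (Int.negSucc m)) -
        laurentDer (evolveDer (flow a (laxB b c (Int.negSucc m)))) (laxB b c n) =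
      laurentBracket dxDer (laxB b c n) (laxB b c (Int.negSucc m)) := by
    intro n m hc
    obtain ⟨K₁, h₁⟩ := hc.isHalf.bracket_mem (lambdaSum_flow (c := c) hb n fun _ => hc)
      (Int.negSucc m) 0
    obtain ⟨K₂, h₂⟩ := hb.isHalf.bracket_mem (lambdaSum_flow hb (Int.negSucc m) fun _ => hc) n 1
    exact zero_curvature_opposite
      (sub_laxB_ofNat_mem b c n (K := K₂ + (n + 1)) (by omega))
      (sub_laxB_negSucc_mem b c m (K := K₁ + (m + 1)) (by omega))
      (laxB_ofNat_mem b c n) (laxB_negSucc_mem b c m) (h₁ _ (by omega)) (h₂ _ (by omega))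
  cases n with
  | ofNat n =>
    cases m with
    | ofNat m =>
      obtain ⟨K₁, h₁⟩ := hb.isHalf.bracket_mem (lambdaSum_flow (c := c) hb n (by omega)) m 1
      obtain ⟨K₂, h₂⟩ := hb.isHalf.bracket_mem (lambdaSum_flow (c := c) hb m (by omega)) n 1
      exact zero_curvature_same (σ := -1) (J := 1) (y := laurentTrunc (-1) (K₁ + K₂ + n + m + 1) b)
        (by omega) le_rfl (sub_laxB_ofNat_mem b c n (by omega))
        (sub_laxB_ofNat_mem b c m (by omega)) (by simpa using laxB_ofNat_mem b c n)
        (by simpa using laxB_ofNat_mem b c m) (h₁ _ (by omega)) (h₂ _ (by omega))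
    | negSucc m => exact opp n m (hc (Or.inr (Int.negSucc_lt_zero m)))
  | negSucc n =>
    have hc' := hc (Or.inl (Int.negSucc_lt_zero n))
    cases m with
    | ofNat m =>
      have h := congrArg Neg.neg (opp m n hc')
      rw [neg_sub] at h
      refine h.trans ?_
      simp only [laurentBracket, Int.ofNat_eq_natCast]
      ring
    | negSucc m =>
      obtain ⟨K₁, h₁⟩ := hc'.isHalf.bracket_mem
        (lambdaSum_flow (c := c) hb (Int.negSucc n) fun _ => hc') (Int.negSucc m) 0
      obtain ⟨K₂, h₂⟩ := hc'.isHalf.bracket_mem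
        (lambdaSum_flow (c := c) hb (Int.negSucc m) fun _ => hc') (Int.negSucc n) 0
      exact zero_curvature_same (σ := 1) (J := 0) (y := laurentTrunc 1 (K₁ + K₂ + n + m + 1) c)
        le_rfl (by omega) (sub_laxB_negSucc_mem b c n (by omega))
        (sub_laxB_negSucc_mem b c m (by omega)) (by simpa using laxB_negSucc_mem b c n)
        (by simpa using laxB_negSucc_mem b c m) (h₁ _ (by omega)) (h₂ _ (by omega))

/-- The flows commute. -/
theorem evolve_flow_comm {b c : PowerSeries (DiffSeries M)} (hb : IsSeriesB a b) (n m : ℤ)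
    (hc : n < 0 ∨ m < 0 → IsSeriesC a c) (f : DiffSeries M) :
    evolve (flow a (laxB b c n)) (evolve (flow a (laxB b c m)) f) =
      evolve (flow a (laxB b c m)) (evolve (flow a (laxB b c n)) f) := by
  refine evolve_comm (fun i => ?_) f
  have hA : ∀ k : ℤ, (k < 0 → IsSeriesC a c) →
      laurentDer (evolveDer (flow a (laxB b c k))) (lambdaSum (wHat M)) =
      laurentLax dxDer (eps M) (lambdaSum (wHat M)) (lambdaSum (aHat M a)) (laxB b c k) := by
    intro k hk
    rw [evolveDer_lambdaSum_wHat, lambdaSum_flow hb k hk, laxRHS_eq]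
  have h := laurentLax_compat (isEvolutionary_evolveDer (flow a (laxB b c n))).map_eps
    (isEvolutionary_evolveDer (flow a (laxB b c m))).map_eps isEvolutionary_dxDer.map_eps
    (evolveDer_dxDer_comm _) (evolveDer_dxDer_comm _) (laurentDer_aHat dxDer a)
    (laurentDer_aHat _ a) (laurentDer_aHat _ a) (hA n fun h => hc (Or.inl h))
    (hA m fun h => hc (Or.inr h)) (zero_curvature hb n m hc)
  rw [← laxRHS_eq, ← laxRHS_eq] at h
  -- Flows act on Laurent polynomials coefficientwise, so the coefficient of `λⁱ` is exactly the
  -- commutation condition on `wⁱ`.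
  exact congrArg (fun g : LaurentPolynomial (DiffSeries M) => g.coeff ((i : ℕ) : ℤ)) h

end Flows

/-! ### Existence and uniqueness of `b` and `c` by a contraction in double power series. -/

section Existence

/-- The double power series whose terms have total degree at least `n`. -/
def totalFil (R : Type*) [CommRing R] (n : ℕ) : AddSubgroup (PowerSeries (PowerSeries R)) where
  carrier := {y | ∀ k d, k + d < n → PowerSeries.coeff d (PowerSeries.coeff k y) = 0}
  add_mem' hy hz k d h := by rw [map_add, map_add, hy k d h, hz k d h, add_zero]
  zero_mem' k d _ := by rw [map_zero, map_zero]
  neg_mem' hy k d h := by rw [map_neg, map_neg, hy k d h, neg_zero]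

section

variable {R : Type*} [CommRing R]

theorem mul_mem_totalFil {m n : ℕ} {y z : PowerSeries (PowerSeries R)} (hy : y ∈ totalFil R m)
    (hz : z ∈ totalFil R n) : y * z ∈ totalFil R (m + n) := by
  intro k d h
  rw [PowerSeries.coeff_mul, map_sum]
  refine Finset.sum_eq_zero fun p hp => ?_
  rw [PowerSeries.coeff_mul]
  refine Finset.sum_eq_zero fun q hq => ?_
  have hp' := Finset.HasAntidiagonal.mem_antidiagonal.mp hp
  have hq' := Finset.HasAntidiagonal.mem_antidiagonal.mp hq
  by_cases h1 : p.1 + q.1 < m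
  · rw [hy _ _ h1, zero_mul]
  · rw [hz p.2 q.2 (by omega), mul_zero]

theorem mem_totalFil_zero (y : PowerSeries (PowerSeries R)) : y ∈ totalFil R 0 :=
  fun _ _ h => absurd h (Nat.not_lt_zero _)

theorem mul_mem_totalFil_right {n : ℕ} (y : PowerSeries (PowerSeries R))
    {z : PowerSeries (PowerSeries R)} (hz : z ∈ totalFil R n) : y * z ∈ totalFil R n := by
  simpa using mul_mem_totalFil (mem_totalFil_zero y) hz

theorem eq_of_forall_sub_mem_totalFil {y z : PowerSeries (PowerSeries R)}
    (h : ∀ n, y - z ∈ totalFil R n) : y = z := by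
  ext k d
  have := h (k + d + 1) k d (Nat.lt_succ_self _)
  rwa [map_sub, map_sub, sub_eq_zero] at this

theorem mem_totalFil_one {y : PowerSeries (PowerSeries R)} :
    y ∈ totalFil R 1 ↔ PowerSeries.constantCoeff (PowerSeries.constantCoeff y) = 0 := by
  rw [← PowerSeries.coeff_zero_eq_constantCoeff_apply,
    ← PowerSeries.coeff_zero_eq_constantCoeff_apply]
  refine ⟨fun h => h 0 0 Nat.one_pos, fun h k d hkd => ?_⟩
  obtain ⟨rfl, rfl⟩ : k = 0 ∧ d = 0 := by omega
  exact h

variable {N : PowerSeries (PowerSeries R) → PowerSeries (PowerSeries R)}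
  {S : Set (PowerSeries (PowerSeries R))}

/-- A contraction for the filtration by the total degree has at most one fixed point. -/
theorem fixedPoint_unique
    (hN : ∀ y ∈ S, ∀ z ∈ S, ∀ n, y - z ∈ totalFil R n → N y - N z ∈ totalFil R (n + 1))
    {y z : PowerSeries (PowerSeries R)} (hy : y ∈ S) (hz : z ∈ S) (hNy : N y = y)
    (hNz : N z = z) : y = z := by
  refine eq_of_forall_sub_mem_totalFil fun n => ?_
  induction n with
  | zero => exact mem_totalFil_zero _
  | succ n ih =>
    have h := hN y hy z hz n ih
    rwa [hNy, hNz] at h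

/-- A contraction of a closed set for the filtration by the total degree has a fixed point. -/
theorem exists_fixedPoint
    (hN : ∀ y ∈ S, ∀ z ∈ S, ∀ n, y - z ∈ totalFil R n → N y - N z ∈ totalFil R (n + 1))
    (hS : ∀ y ∈ S, N y ∈ S) (hcl : ∀ y, (∀ n, ∃ z ∈ S, y - z ∈ totalFil R n) → y ∈ S)
    (hne : S.Nonempty) : ∃ y ∈ S, N y = y := by
  obtain ⟨y₀, h₀⟩ := hne
  have hit : ∀ n, N^[n] y₀ ∈ S := by
    intro n
    induction n with
    | zero => exact h₀
    | succ n ih =>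
      rw [Function.iterate_succ_apply']
      exact hS _ ih
  have hstep : ∀ n, N^[n + 1] y₀ - N^[n] y₀ ∈ totalFil R n := by
    intro n
    induction n with
    | zero => exact mem_totalFil_zero _
    | succ n ih =>
      have h := hN _ (hit (n + 1)) _ (hit n) n ih
      rwa [← Function.iterate_succ_apply' N, ← Function.iterate_succ_apply' N] at h
  have hdiff : ∀ m n, N^[n + m] y₀ - N^[n] y₀ ∈ totalFil R n := by
    intro m n
    induction m with
    | zero =>
      rw [add_zero, sub_self]
      exact zero_mem _
    | succ m ih =>
      have h1 : N^[n + m + 1] y₀ - N^[n + m] y₀ ∈ totalFil R n :=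
        fun k d h => hstep (n + m) k d (by omega)
      have h := add_mem h1 ih
      rwa [sub_add_sub_cancel] at h
  -- The coefficient of bidegree `(k, d)` no longer changes after `k + d + 1` iterations, so it can
  -- be read off there.
  let y : PowerSeries (PowerSeries R) := PowerSeries.mk fun k => PowerSeries.mk fun d =>
    PowerSeries.coeff d (PowerSeries.coeff k (N^[k + d + 1] y₀))
  have hy : ∀ n, y - N^[n] y₀ ∈ totalFil R n := by
    intro n k d h
    obtain ⟨m, rfl⟩ : ∃ m, n = k + d + 1 + m := ⟨n - (k + d + 1), by omega⟩
    have h1 := hdiff m (k + d + 1) k d (Nat.lt_succ_self _)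
    rw [map_sub, map_sub, sub_eq_zero] at h1 ⊢
    rw [h1, PowerSeries.coeff_mk, PowerSeries.coeff_mk]
  have hyS : y ∈ S := hcl y fun n => ⟨_, hit n, hy n⟩
  refine ⟨y, hyS, eq_of_forall_sub_mem_totalFil fun n => ?_⟩
  have h1 := hN y hyS _ (hit n) n (hy n)
  rw [← Function.iterate_succ_apply' N] at h1
  have h2 := sub_mem h1 (hy (n + 1))
  rw [sub_sub_sub_cancel_right] at h2
  exact fun k d h => h2 k d (by omega)

end

variable {r : ℕ} {M : Opens (Fin r → ℝ)}

@[simp] theorem coeff_dxSeries (y : PowerSeries (DiffSeries M)) (k : ℕ) :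
    PowerSeries.coeff k (dxSeries y) = dx (PowerSeries.coeff k y) :=
  PowerSeries.coeff_mk _ _

theorem dxSeries_sub (y z : PowerSeries (DiffSeries M)) :
    dxSeries (y - z) = dxSeries y - dxSeries z := by
  ext1 k
  simp only [coeff_dxSeries, map_sub, ← dxDer_apply]

theorem dxSeries_mem {n : ℕ} {y : PowerSeries (DiffSeries M)} (hy : y ∈ totalFil (DiffPoly M) n) :
    dxSeries y ∈ totalFil (DiffPoly M) n := by
  intro k d h
  rw [coeff_dxSeries, dx, PowerSeries.coeff_mk, hy k d h, ← dxPolyDer_apply, map_zero]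

/-- The constant `(1/4) ε²`. -/
def quarterEps (M : Opens (Fin r → ℝ)) : PowerSeries (DiffSeries M) :=
  PowerSeries.C (algebraMap ℝ (DiffSeries M) (1 / 4) * eps M ^ 2)

theorem quarterEps_mem : quarterEps M ∈ totalFil (DiffPoly M) 1 := by
  rw [mem_totalFil_one]
  simp [quarterEps, eps]

/-- A quasi-Newton step for the equation `quadratic P Q y = 1`. -/
def quadraticStep (φ P Q y : PowerSeries (DiffSeries M)) : PowerSeries (DiffSeries M) :=
  y + PowerSeries.C (algebraMap ℝ (DiffSeries M) (1 / 2)) * φ * (1 - quadratic P Q y)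

theorem two_mul_C_half : 2 * PowerSeries.C (algebraMap ℝ (DiffSeries M) (1 / 2)) = 1 := by
  rw [← map_ofNat (PowerSeries.C (R := DiffSeries M)) 2, ← map_mul,
    ← map_ofNat (algebraMap ℝ (DiffSeries M)) 2, ← map_mul]
  norm_num

/-- Since `Pφ² ≡ 1`, the factor `φ/2` inverts the derivative `2Pφ` of `y ↦ Py²` to leading order.
The difference of the steps is `(y - z)(1 - ½φP(y + z))` plus a term carrying `ε²`. The second
factor has positive order because `y + z ≡ 2φ`, and `∂_x` does not lower the total degree. -/
theorem quadraticStep_contraction {φ P Q y z : PowerSeries (DiffSeries M)} {n : ℕ}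
    (hφ : P * φ ^ 2 - 1 ∈ totalFil (DiffPoly M) 1) (hy : y - φ ∈ totalFil (DiffPoly M) 1)
    (hz : z - φ ∈ totalFil (DiffPoly M) 1) (h : y - z ∈ totalFil (DiffPoly M) n) :
    quadraticStep φ P Q y - quadraticStep φ P Q z ∈ totalFil (DiffPoly M) (n + 1) := by
  have h1 := dxSeries_mem h
  have h2 := dxSeries_mem h1
  rw [dxSeries_sub] at h1 h2
  rw [dxSeries_sub] at h2
  set c : PowerSeries (DiffSeries M) := PowerSeries.C (algebraMap ℝ (DiffSeries M) (1 / 2)) with hc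
  have hc2 : 2 * c = 1 := two_mul_C_half
  have e1 : (1 - c * φ * P * (y + z)) ∈ totalFil (DiffPoly M) 1 := by
    have h3 := sub_mem (neg_mem hφ) (mul_mem_totalFil_right (c * φ * P) (add_mem hy hz))
    convert h3 using 1
    linear_combination (-P * φ ^ 2) * hc2
  have e2 : y * dxSeries (dxSeries y) - z * dxSeries (dxSeries z) ∈ totalFil (DiffPoly M) n := by
    have h3 := add_mem (mul_mem_totalFil_right (dxSeries (dxSeries y)) h)
      (mul_mem_totalFil_right z h2)
    convert h3 using 1
    ring
  have e3 : dxSeries y ^ 2 - dxSeries z ^ 2 ∈ totalFil (DiffPoly M) n := by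
    have h3 := mul_mem_totalFil_right (dxSeries y + dxSeries z) h1
    convert h3 using 1
    ring
  have e4 := add_mem (mul_mem_totalFil h e1) (mul_mem_totalFil_right (c * φ * Q)
    (mul_mem_totalFil (sub_mem (mul_mem_totalFil_right 2 e2) e3) quarterEps_mem))
  convert e4 using 1
  simp only [quadraticStep, quadratic, quarterEps, ← hc]
  ring

theorem quadratic_sub_one_mem {φ P Q y : PowerSeries (DiffSeries M)}
    (hφ : P * φ ^ 2 - 1 ∈ totalFil (DiffPoly M) 1) (hy : y - φ ∈ totalFil (DiffPoly M) 1) :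
    1 - quadratic P Q y ∈ totalFil (DiffPoly M) 1 := by
  have h := add_mem (sub_mem (neg_mem hφ) (mul_mem_totalFil_right (P * (y + φ)) hy))
    (mul_mem_totalFil_right (Q * (2 * y * dxSeries (dxSeries y) - dxSeries y ^ 2))
      (quarterEps_mem (M := M)))
  convert h using 1
  simp only [quadratic, quarterEps]
  ring

theorem quadraticStep_eq_self_iff {φ P Q y : PowerSeries (DiffSeries M)} (hφ : IsUnit φ) :
    quadraticStep φ P Q y = y ↔ quadratic P Q y = 1 := by
  have hc : IsUnit (PowerSeries.C (algebraMap ℝ (DiffSeries M) (1 / 2))) :=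
    IsUnit.of_mul_eq_one_right _ two_mul_C_half
  rw [quadraticStep, add_eq_left, (hc.mul hφ).mul_right_eq_zero, sub_eq_zero, eq_comm]

/-! ### Stability of the ring `𝒜` under the iteration. -/

/-- The power series with coefficients in the ring `𝒜`. -/
def seriesA (M : Opens (Fin r → ℝ)) : Subring (PowerSeries (DiffSeries M)) where
  carrier := {y | ∀ k, PowerSeries.coeff k y ∈ ringA M}
  mul_mem' hy hz k := by
    rw [PowerSeries.coeff_mul]
    exact sum_mem fun p _ => mul_mem (hy _) (hz _)
  one_mem' k := by
    rw [PowerSeries.coeff_one]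
    split_ifs
    · exact one_mem _
    · exact zero_mem _
  add_mem' hy hz k := by
    rw [map_add]
    exact add_mem (hy k) (hz k)
  zero_mem' k := by
    rw [map_zero]
    exact zero_mem _
  neg_mem' hy k := by
    rw [map_neg]
    exact neg_mem (hy k)

theorem C_C_mem_ringA (f : SmoothFun M) : PowerSeries.C (MvPolynomial.C f) ∈ ringA M := by
  intro d
  rw [PowerSeries.coeff_C]
  split_ifs with h
  · subst h
    exact MvPolynomial.isWeightedHomogeneous_C _ f
  · exact MvPolynomial.isWeightedHomogeneous_zero _ _ _

theorem algebraMap_mem_ringA (c : ℝ) : algebraMap ℝ (DiffSeries M) c ∈ ringA M := by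
  rw [PowerSeries.algebraMap_apply, MvPolynomial.algebraMap_apply]
  exact C_C_mem_ringA _

theorem C_mem_seriesA {f : DiffSeries M} (hf : f ∈ ringA M) : PowerSeries.C f ∈ seriesA M := by
  intro k
  rw [PowerSeries.coeff_C]
  split_ifs
  · exact hf
  · exact zero_mem _

theorem X_mem_seriesA : (PowerSeries.X : PowerSeries (DiffSeries M)) ∈ seriesA M := by
  intro k
  rw [PowerSeries.coeff_X]
  split_ifs
  · exact one_mem _
  · exact zero_mem _

/-- The weight `w^{i,s} ↦ s` of the jet variables. -/
def jetWeight (r : ℕ) : Fin r × ℕ → ℕ := fun v => v.2 + 1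

theorem isWeightedHomogeneous_partialCoeff {p : DiffPoly M} {d : ℕ} (i : Fin r)
    (hp : p.IsWeightedHomogeneous (jetWeight r) d) :
    (partialCoeff i p).IsWeightedHomogeneous (jetWeight r) d := by
  intro m hm
  refine hp fun h => hm ?_
  rw [coeff_partialCoeff, h, partialW_zero]

/-- On each monomial the derivation replaces one factor `w^{i,s}` by `w^{i,s+1}`, which raises the
weight by exactly one. -/
theorem isWeightedHomogeneous_shift {p : DiffPoly M} {d : ℕ}
    (hp : p.IsWeightedHomogeneous (jetWeight r) d) :
    (MvPolynomial.mkDerivation (SmoothFun M)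
      (fun v : Fin r × ℕ => (MvPolynomial.X (v.1, v.2 + 1) : DiffPoly M)) p).IsWeightedHomogeneous
      (jetWeight r) (d + 1) := by
  rw [p.as_sum, map_sum]
  refine (MvPolynomial.weightedHomogeneousSubmodule _ _ _).sum_mem fun m hm => ?_
  rw [MvPolynomial.mkDerivation_monomial]
  refine Submodule.smul_mem _ _ (Submodule.sum_mem _ fun v hv => ?_)
  have hw : Finsupp.weight (jetWeight r) m = d := hp (MvPolynomial.mem_support_iff.mp hm)
  have h1 : Finsupp.single v 1 ≤ m := by
    rw [Finsupp.single_le_iff]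
    exact Nat.one_le_iff_ne_zero.mpr (Finsupp.mem_support_iff.mp hv)
  have h2 : Finsupp.weight (jetWeight r) (m - Finsupp.single v 1) + jetWeight r v = d := by
    have h3 := congrArg (Finsupp.weight (jetWeight r)) (tsub_add_cancel_of_le h1)
    rw [map_add, Finsupp.weight_single, hw, one_smul] at h3
    exact h3
  have h3 : d + 1 = Finsupp.weight (jetWeight r) (m - Finsupp.single v 1) +
      jetWeight r (v.1, v.2 + 1) := by
    simp only [jetWeight] at h2 ⊢
    omega
  rw [h3]
  exact (MvPolynomial.isWeightedHomogeneous_monomial _ _ _ rfl).mul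
    (MvPolynomial.isWeightedHomogeneous_X _ _ _)

theorem isWeightedHomogeneous_dxPoly {p : DiffPoly M} {d : ℕ}
    (hp : p.IsWeightedHomogeneous (jetWeight r) d) :
    (dxPoly p).IsWeightedHomogeneous (jetWeight r) (d + 1) := by
  refine MvPolynomial.IsWeightedHomogeneous.add ?_ (isWeightedHomogeneous_shift hp)
  refine (MvPolynomial.weightedHomogeneousSubmodule _ _ _).sum_mem fun i _ => ?_
  rw [add_comm]
  exact (MvPolynomial.isWeightedHomogeneous_X (SmoothFun M) (jetWeight r) (i, 0)).mul
    (isWeightedHomogeneous_partialCoeff i hp)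

/-- `∂_x` raises the differential degree by one at a fixed power of `ε`, hence does not preserve
`𝒜`; the factor `ε` restores the balance. -/
theorem eps_mul_dx_mem_ringA {f : DiffSeries M} (hf : f ∈ ringA M) : eps M * dx f ∈ ringA M := by
  intro d
  cases d with
  | zero =>
    rw [eps, PowerSeries.coeff_zero_X_mul]
    exact MvPolynomial.isWeightedHomogeneous_zero _ _ _
  | succ d =>
    rw [eps, PowerSeries.coeff_succ_X_mul, dx, PowerSeries.coeff_mk]
    exact isWeightedHomogeneous_dxPoly (hf d)

theorem C_eps_mul_dxSeries_mem {y : PowerSeries (DiffSeries M)} (hy : y ∈ seriesA M) :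
    PowerSeries.C (eps M) * dxSeries y ∈ seriesA M := by
  intro k
  rw [PowerSeries.coeff_C_mul, coeff_dxSeries]
  exact eps_mul_dx_mem_ringA (hy k)

theorem dxSeries_C_eps_mul (y : PowerSeries (DiffSeries M)) :
    dxSeries (PowerSeries.C (eps M) * y) = PowerSeries.C (eps M) * dxSeries y := by
  ext1 k
  rw [coeff_dxSeries, PowerSeries.coeff_C_mul, PowerSeries.coeff_C_mul, coeff_dxSeries,
    ← dxDer_apply, Derivation.leibniz, isEvolutionary_dxDer.map_eps, dxDer_apply]
  simp

/-- Every term of the correction has two `x`-derivatives, and the factor `ε²` provides one `ε` for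
each. -/
theorem quadratic_mem_seriesA {P Q y : PowerSeries (DiffSeries M)} (hP : P ∈ seriesA M)
    (hQ : Q ∈ seriesA M) (hy : y ∈ seriesA M) : quadratic P Q y ∈ seriesA M := by
  have h1 := C_eps_mul_dxSeries_mem hy
  have h2 := C_eps_mul_dxSeries_mem h1
  rw [dxSeries_C_eps_mul] at h2
  have h := sub_mem (mul_mem hP (pow_mem hy 2))
    (mul_mem (mul_mem (C_mem_seriesA (algebraMap_mem_ringA (M := M) (1 / 4))) hQ)
      (sub_mem (mul_mem (add_mem hy hy) h2) (pow_mem h1 2)))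
  convert h using 1
  simp only [quadratic, map_mul, map_pow]
  ring

theorem quadraticStep_mem_seriesA {φ P Q y : PowerSeries (DiffSeries M)} (hφ : φ ∈ seriesA M)
    (hP : P ∈ seriesA M) (hQ : Q ∈ seriesA M) (hy : y ∈ seriesA M) :
    quadraticStep φ P Q y ∈ seriesA M :=
  add_mem hy (mul_mem (mul_mem (C_mem_seriesA (algebraMap_mem_ringA _)) hφ)
    (sub_mem (one_mem _) (quadratic_mem_seriesA hP hQ hy)))

theorem mem_seriesA_of_forall {y : PowerSeries (DiffSeries M)}
    (h : ∀ n, ∃ z ∈ seriesA M, y - z ∈ totalFil (DiffPoly M) n) : y ∈ seriesA M := by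
  intro k d
  obtain ⟨z, hz, hyz⟩ := h (k + d + 1)
  have := hyz k d (Nat.lt_succ_self _)
  rw [map_sub, map_sub, sub_eq_zero] at this
  rw [this]
  exact hz k d

/-- Two solutions with the same leading term coincide. -/
theorem quadratic_unique {φ P Q y z : PowerSeries (DiffSeries M)} (hu : IsUnit φ)
    (hφ : P * φ ^ 2 - 1 ∈ totalFil (DiffPoly M) 1)
    (hy : y - φ ∈ totalFil (DiffPoly M) 1) (hz : z - φ ∈ totalFil (DiffPoly M) 1)
    (hqy : quadratic P Q y = 1) (hqz : quadratic P Q z = 1) : y = z :=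
  fixedPoint_unique (N := quadraticStep φ P Q) (S := {y | y - φ ∈ totalFil (DiffPoly M) 1})
    (fun _ h₁ _ h₂ _ h => quadraticStep_contraction hφ h₁ h₂ h) hy hz
    ((quadraticStep_eq_self_iff hu).mpr hqy) ((quadraticStep_eq_self_iff hu).mpr hqz)

/-- A solution with a given leading term, in a closed set which is stable under the iteration. -/
theorem quadratic_exists {φ P Q : PowerSeries (DiffSeries M)} (hu : IsUnit φ)
    (hφ : P * φ ^ 2 - 1 ∈ totalFil (DiffPoly M) 1) (hφA : φ ∈ seriesA M) (hP : P ∈ seriesA M)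
    (hQ : Q ∈ seriesA M) (S : Set (PowerSeries (DiffSeries M))) (hφS : φ ∈ S)
    (hS : ∀ y ∈ S, quadraticStep φ P Q y ∈ S)
    (hcl : ∀ y, (∀ n, ∃ z ∈ S, y - z ∈ totalFil (DiffPoly M) n) → y ∈ S) :
    ∃ y ∈ S, y ∈ seriesA M ∧ quadratic P Q y = 1 := by
  have hstep : ∀ y, y - φ ∈ totalFil (DiffPoly M) 1 →
      quadraticStep φ P Q y - φ ∈ totalFil (DiffPoly M) 1 := fun y hy => by
    have h := add_mem hy (mul_mem_totalFil_right
      (PowerSeries.C (algebraMap ℝ (DiffSeries M) (1 / 2)) * φ)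
      (quadratic_sub_one_mem (Q := Q) hφ hy))
    rwa [sub_add_eq_add_sub] at h
  obtain ⟨y, hy, hfix⟩ := exists_fixedPoint (N := quadraticStep φ P Q)
    (S := {y | y - φ ∈ totalFil (DiffPoly M) 1 ∧ y ∈ seriesA M ∧ y ∈ S})
    (fun _ h₁ _ h₂ _ h => quadraticStep_contraction hφ h₁.1 h₂.1 h)
    (fun y hy => ⟨hstep y hy.1, quadraticStep_mem_seriesA hφA hP hQ hy.2.1, hS y hy.2.2⟩)
    (fun y hy => ⟨by
        obtain ⟨z, hz, h⟩ := hy 1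
        have h' := add_mem h hz.1
        rwa [sub_add_sub_cancel] at h',
      mem_seriesA_of_forall fun n => let ⟨z, hz, h⟩ := hy n; ⟨z, hz.2.1, h⟩,
      hcl y fun n => let ⟨z, hz, h⟩ := hy n; ⟨z, hz.2.2, h⟩⟩)
    ⟨φ, by rw [sub_self]; exact zero_mem _, hφA, hφS⟩
  exact ⟨y, hy.2.2, hy.2.1, (quadraticStep_eq_self_iff hu).mp hfix⟩

theorem wHat_mem_ringA (i : Fin (r + 1)) : wHat M i ∈ ringA M := by
  refine Fin.lastCases ?_ (fun i => ?_) i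
  · rw [wHat, Fin.snoc_last]
    exact one_mem _
  · rw [wHat, Fin.snoc_castSucc]
    exact C_C_mem_ringA _

theorem sum_C_mul_X_pow_mem {y : Fin (r + 1) → DiffSeries M} (hy : ∀ i, y i ∈ ringA M)
    (e : Fin (r + 1) → ℕ) : ∑ i, PowerSeries.C (y i) * PowerSeries.X ^ e i ∈ seriesA M :=
  sum_mem fun i _ => mul_mem (C_mem_seriesA (hy i)) (pow_mem X_mem_seriesA _)

/-- In the variable `λ⁻¹` the series `P` starts with 1, so `φ = 1` is an approximate solution. -/
theorem existsUnique_isSeriesB (a : Fin (r + 1) → ℝ) :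
    ∃! b : PowerSeries (DiffSeries M), IsSeriesB a b := by
  set P : PowerSeries (DiffSeries M) :=
    ∑ i : Fin (r + 1), PowerSeries.C (wHat M i) * PowerSeries.X ^ (r - (i : ℕ)) with hP
  set Q : PowerSeries (DiffSeries M) :=
    ∑ i : Fin (r + 1), PowerSeries.C (aHat M a i) * PowerSeries.X ^ (r - (i : ℕ)) with hQ
  have hP0 : PowerSeries.constantCoeff P = 1 := by
    have h : ∀ i : Fin r, r - (i : ℕ) ≠ 0 := fun i => by have := i.2; omega
    rw [hP, map_sum, Fin.sum_univ_castSucc, wHat, Fin.snoc_last]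
    simp [h]
  have hφ : P * 1 ^ 2 - 1 ∈ totalFil (DiffPoly M) 1 := by
    rw [mem_totalFil_one]
    simp [hP0]
  have hdx : dx (1 : DiffSeries M) = 0 := by
    rw [← dxDer_apply, Derivation.map_one_eq_zero]
  have hdx0 : dx (0 : DiffSeries M) = 0 := by rw [← dxDer_apply, map_zero]
  have hd : ∀ y : PowerSeries (DiffSeries M), PowerSeries.constantCoeff (dxSeries y) =
      dx (PowerSeries.constantCoeff y) := fun y => by
    rw [← PowerSeries.coeff_zero_eq_constantCoeff_apply, coeff_dxSeries,
      PowerSeries.coeff_zero_eq_constantCoeff_apply]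
  -- Closeness to `φ` controls only the coefficient at `λ⁰ε⁰`, whereas the normalization of `b`
  -- concerns all orders in `ε`. It is therefore imposed through the closed set; the step preserves
  -- it because 1 solves the equation at `λ⁰` exactly.
  obtain ⟨b, hb0, hbA, hb⟩ := quadratic_exists isUnit_one hφ (one_mem _)
    (sum_C_mul_X_pow_mem wHat_mem_ringA _ : P ∈ seriesA M)
    (sum_C_mul_X_pow_mem (fun i => algebraMap_mem_ringA (a i)) _ : Q ∈ seriesA M)
    {y | PowerSeries.constantCoeff y = 1} (by simp)
    (fun y (hy : PowerSeries.constantCoeff y = 1) => by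
      simp [quadraticStep, quadratic, hd, hy, hdx, hdx0, hP0])
    (fun y hy => by
      change PowerSeries.constantCoeff y = 1
      ext1 d
      obtain ⟨z, hz, h⟩ := hy (d + 1)
      have h1 := h 0 d (by omega)
      rwa [map_sub, map_sub, sub_eq_zero, PowerSeries.coeff_zero_eq_constantCoeff_apply,
        PowerSeries.coeff_zero_eq_constantCoeff_apply, hz] at h1)
  have hb1 : PowerSeries.coeff 0 b = 1 :=
    (PowerSeries.coeff_zero_eq_constantCoeff_apply b).trans hb0
  refine ⟨b, ⟨hb1, hbA, hb⟩, fun b' hb' => ?_⟩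
  have hb0' : PowerSeries.constantCoeff b' = 1 :=
    (PowerSeries.coeff_zero_eq_constantCoeff_apply b').symm.trans hb'.1
  have hmem : ∀ y : PowerSeries (DiffSeries M), PowerSeries.constantCoeff y = 1 →
      y - 1 ∈ totalFil (DiffPoly M) 1 := fun y hy => by
    rw [mem_totalFil_one]
    simp [hy]
  exact quadratic_unique isUnit_one hφ (hmem _ hb0') (hmem _ hb0) hb'.2.2 hb

/-! ### The leading coefficient, and the sign ambiguity of `c`. -/

/-- The leading coefficient of a double series. -/
def leadingTerm (M : Opens (Fin r → ℝ)) : PowerSeries (DiffSeries M) →+* DiffPoly M :=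
  (PowerSeries.constantCoeff (R := DiffPoly M)).comp
    (PowerSeries.constantCoeff (R := DiffSeries M))

theorem mem_totalFil_one_iff {y : PowerSeries (DiffSeries M)} :
    y ∈ totalFil (DiffPoly M) 1 ↔ leadingTerm M y = 0 := mem_totalFil_one

theorem leadingTerm_C_C (p : DiffPoly M) :
    leadingTerm M (PowerSeries.C (PowerSeries.C p)) = p := by
  simp [leadingTerm]

theorem leadingTerm_quadratic (P Q y : PowerSeries (DiffSeries M)) :
    leadingTerm M (quadratic P Q y) = leadingTerm M P * leadingTerm M y ^ 2 := by
  have h : leadingTerm M (quarterEps M) = 0 := mem_totalFil_one_iff.mp quarterEps_mem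
  change leadingTerm M (P * y ^ 2 - quarterEps M * Q * _) = _
  rw [map_sub, map_mul, map_mul, map_mul, h]
  simp

theorem isUnit_leading {P Q y : PowerSeries (DiffSeries M)} (h : quadratic P Q y = 1) :
    leadingTerm M P * leadingTerm M y ^ 2 = 1 := by
  rw [← leadingTerm_quadratic P Q y, h, map_one]

/-- The leading coefficient is homogeneous of weight zero and every jet variable has positive
weight, so no jet variable occurs. -/
theorem exists_leadingTerm_eq_C {y : PowerSeries (DiffSeries M)} (hy : y ∈ seriesA M) :
    ∃ g : SmoothFun M, leadingTerm M y = MvPolynomial.C g := by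
  have h := hy 0 0
  rw [PowerSeries.coeff_zero_eq_constantCoeff_apply,
    PowerSeries.coeff_zero_eq_constantCoeff_apply] at h
  refine ⟨MvPolynomial.coeff 0 (leadingTerm M y), ?_⟩
  classical
  ext1 m
  rw [MvPolynomial.coeff_C]
  split_ifs with hm
  · rw [hm]
  · by_contra hne
    have hw := h hne
    rw [Finsupp.weight_apply, Finsupp.sum, Finset.sum_eq_zero_iff] at hw
    refine hm (Finsupp.ext fun v => ?_).symm
    by_contra hv
    have h1 := hw v (Finsupp.mem_support_iff.mpr hv)
    simp at h1
    exact hv (by simpa using h1)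

theorem coordFun_apply (i : Fin r) (u : M) : coordFun M i u = u.1 i := rfl

theorem IsSeriesC.neg {a : Fin (r + 1) → ℝ} {c : PowerSeries (DiffSeries M)}
    (h : IsSeriesC a c) : IsSeriesC a (-c) := by
  have hd : ∀ y : PowerSeries (DiffSeries M), dxSeries (-y) = -dxSeries y := fun y => by
    ext1 k
    simp only [coeff_dxSeries, map_neg, ← dxDer_apply]
  refine ⟨(seriesA M).neg_mem h.1, ?_⟩
  rw [← h.2]
  simp only [quadratic, hd]
  ring

variable [NeZero r]

theorem leadingTerm_P : leadingTerm M
    (∑ i : Fin (r + 1), PowerSeries.C (wHat M i) * PowerSeries.X ^ (i : ℕ)) =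
      MvPolynomial.C (coordFun M 0) := by
  rw [map_sum, Finset.sum_eq_single 0]
  · have h : (0 : Fin (r + 1)) = Fin.castSucc (0 : Fin r) := (Fin.castSucc_zero').symm
    have hw : wHat M 0 = PowerSeries.C (MvPolynomial.C (coordFun M 0)) := by
      rw [h, wHat, Fin.snoc_castSucc]
    rw [hw]
    simp [leadingTerm]
  · intro i _ hi
    have hi' : (i : ℕ) ≠ 0 := fun h => hi (Fin.ext h)
    simp [leadingTerm, hi']
  · simp

/-- The leading coefficient of a solution `c` is a square root of `1 / w⁰`. -/
theorem IsSeriesC.exists_leadingTerm {a : Fin (r + 1) → ℝ} {c : PowerSeries (DiffSeries M)}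
    (h : IsSeriesC a c) : ∃ g : SmoothFun M, leadingTerm M c = MvPolynomial.C g ∧
      coordFun M 0 * g ^ 2 = 1 := by
  obtain ⟨g, hg⟩ := exists_leadingTerm_eq_C h.1
  have h1 := isUnit_leading h.2
  rw [leadingTerm_P, hg, ← map_pow, ← map_mul, ← map_one MvPolynomial.C] at h1
  exact ⟨g, hg, MvPolynomial.C_injective _ _ h1⟩

theorem leading_hypotheses {g : SmoothFun M} (hg : coordFun M 0 * g ^ 2 = 1) :
    IsUnit (PowerSeries.C (PowerSeries.C (MvPolynomial.C g)) : PowerSeries (DiffSeries M)) ∧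
    (∑ i : Fin (r + 1), PowerSeries.C (wHat M i) * PowerSeries.X ^ (i : ℕ)) *
      PowerSeries.C (PowerSeries.C (MvPolynomial.C g)) ^ 2 - 1 ∈ totalFil (DiffPoly M) 1 := by
  constructor
  · have hu : IsUnit g := IsUnit.of_mul_eq_one (coordFun M 0 * g) (by rw [← hg]; ring)
    exact ((hu.map MvPolynomial.C).map PowerSeries.C).map PowerSeries.C
  · rw [mem_totalFil_one_iff, map_sub, map_mul, map_pow, leadingTerm_P, leadingTerm_C_C, ← map_pow,
      ← map_mul, hg, map_one, map_one, sub_self]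

theorem IsSeriesC.eq_of_leadingTerm_eq {a : Fin (r + 1) → ℝ} {c c' : PowerSeries (DiffSeries M)}
    (h : IsSeriesC a c) (h' : IsSeriesC a c') (hl : leadingTerm M c' = leadingTerm M c) :
    c' = c := by
  obtain ⟨g, hg, hgg⟩ := h.exists_leadingTerm
  obtain ⟨hu, hφ⟩ := leading_hypotheses hgg
  refine quadratic_unique hu hφ ?_ ?_ h'.2 h.2
  · rw [mem_totalFil_one_iff, map_sub, leadingTerm_C_C, hl, hg, sub_self]
  · rw [mem_totalFil_one_iff, map_sub, leadingTerm_C_C, hg, sub_self]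

/-- The two leading terms are continuous, nowhere zero and have the same square `1/w⁰`. On a
connected `M` they differ by one global sign, and the leading term determines the solution.
Contractibility of `M` enters only through this connectedness. -/
theorem IsSeriesC.eq_or_eq_neg [PreconnectedSpace M] {a : Fin (r + 1) → ℝ}
    {c c' : PowerSeries (DiffSeries M)} (h : IsSeriesC a c) (h' : IsSeriesC a c') :
    c' = c ∨ c' = -c := by
  obtain ⟨g, hg, hgg⟩ := h.exists_leadingTerm
  obtain ⟨g', hg', hgg'⟩ := h'.exists_leadingTerm
  have key : ∀ {g : SmoothFun M}, coordFun M 0 * g ^ 2 = 1 → ∀ u : M, u.1 0 * g u ^ 2 = 1 :=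
    fun {g} hg u => by simpa [coordFun_apply] using congrArg (fun f : SmoothFun M => f u) hg
  have hsq : Set.EqOn ((g' : M → ℝ) ^ 2) ((g : M → ℝ) ^ 2) Set.univ := by
    intro u _
    have h1 := key hgg u
    have h2 := key hgg' u
    have h0 : u.1 0 ≠ 0 := left_ne_zero_of_mul_eq_one h1
    exact mul_left_cancel₀ h0 (h2.trans h1.symm)
  rcases isPreconnected_univ.eq_or_eq_neg_of_sq_eq g'.contMDiff.continuous.continuousOn
    g.contMDiff.continuous.continuousOn hsq
    (fun {u} _ h0 => by
      have h1 := key hgg u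
      rw [h0] at h1
      simp at h1) with h1 | h1
  · left
    refine h.eq_of_leadingTerm_eq h' ?_
    have : g' = g := by
      ext u
      exact h1 (Set.mem_univ u)
    rw [hg, hg', this]
  · right
    refine h.neg.eq_of_leadingTerm_eq h' ?_
    have : g' = -g := by
      ext u
      exact h1 (Set.mem_univ u)
    rw [map_neg, hg, hg', this, map_neg]

/-- The smooth function `1 / √w⁰`. -/
def invSqrtCoord (h : ∀ u ∈ M, 0 < u 0) : SmoothFun M :=
  ⟨fun u => (Real.sqrt (u.1 0))⁻¹, fun u => by
    have h0 : 0 < u.1 0 := h u.1 u.2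
    have h1 : ContDiffAt ℝ ∞ (fun x : Fin r → ℝ => (Real.sqrt (x 0))⁻¹) u.1 :=
      ((contDiff_apply ℝ ℝ (0 : Fin r)).contDiffAt.sqrt h0.ne').inv (Real.sqrt_pos.mpr h0).ne'
    exact contMDiffAt_subtype_iff.mpr h1.contMDiffAt⟩

/-- The leading coefficient of a solution satisfies `w⁰g² = 1`, which forces `w⁰ > 0`. Conversely
`1/√w⁰` is then smooth and starts the iteration; no extra normalization is needed, so the closed set
is everything. -/
theorem exists_isSeriesC_iff (a : Fin (r + 1) → ℝ) :
    (∃ c : PowerSeries (DiffSeries M), IsSeriesC a c) ↔ ∀ u ∈ M, 0 < u 0 := by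
  constructor
  · rintro ⟨c, hc⟩ u hu
    obtain ⟨g, -, hg⟩ := hc.exists_leadingTerm
    have h1 : u 0 * g ⟨u, hu⟩ ^ 2 = 1 := by
      simpa [coordFun_apply] using congrArg (fun f : SmoothFun M => f ⟨u, hu⟩) hg
    exact pos_of_mul_pos_left (h1 ▸ one_pos) (sq_nonneg _)
  · intro h
    have hg : coordFun M 0 * invSqrtCoord h ^ 2 = 1 := by
      ext u
      have h0 : 0 < u.1 0 := h u.1 u.2
      change u.1 0 * ((Real.sqrt (u.1 0))⁻¹ ^ 2) = 1
      rw [inv_pow, Real.sq_sqrt h0.le, mul_inv_cancel₀ h0.ne']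
    obtain ⟨hu, hφ⟩ := leading_hypotheses hg
    obtain ⟨c, -, hcA, hc⟩ := quadratic_exists hu hφ (C_mem_seriesA (C_C_mem_ringA _))
      (sum_C_mul_X_pow_mem wHat_mem_ringA _)
      (sum_C_mul_X_pow_mem (fun i => algebraMap_mem_ringA (a i)) fun i => (i : ℕ))
      Set.univ trivial (fun _ _ => trivial) (fun _ _ => trivial)
    exact ⟨c, hcA, hc⟩

end Existence

end

end RKdVCH

theorem mainTheorem1 (r : ℕ) [NeZero r] (a : Fin (r + 1) → ℝ) (ha : a ≠ 0)
    (M : TopologicalSpace.Opens (Fin r → ℝ)) [ContractibleSpace M] :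
    -- existence and uniqueness of the series `b` and `c`
    (∃! b : PowerSeries (RKdVCH.DiffSeries M), RKdVCH.IsSeriesB a b) ∧
    ((∃ c : PowerSeries (RKdVCH.DiffSeries M), RKdVCH.IsSeriesC a c) ↔ ∀ u ∈ M, 0 < u 0) ∧
    (∀ c c' : PowerSeries (RKdVCH.DiffSeries M),
      RKdVCH.IsSeriesC a c → RKdVCH.IsSeriesC a c' → c' = c ∨ c' = -c) ∧
    -- the flows; the series `c` is needed only where a negative flow occurs
    ∀ b c : PowerSeries (RKdVCH.DiffSeries M), RKdVCH.IsSeriesB a b →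
      -- for `B = B_n` the compatibility condition amounts to an evolutionary system
      (∀ n : ℤ, (n < 0 → RKdVCH.IsSeriesC a c) →
        RKdVCH.lambdaSum (RKdVCH.flow a (RKdVCH.laxB b c n)) =
          RKdVCH.laxRHS a (RKdVCH.laxB b c n)) ∧
      -- the flows commute
      (∀ n m : ℤ, (n < 0 ∨ m < 0 → RKdVCH.IsSeriesC a c) →
        ∀ f : RKdVCH.DiffSeries M,
          RKdVCH.evolve (RKdVCH.flow a (RKdVCH.laxB b c n))
              (RKdVCH.evolve (RKdVCH.flow a (RKdVCH.laxB b c m)) f) =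
            RKdVCH.evolve (RKdVCH.flow a (RKdVCH.laxB b c m))
              (RKdVCH.evolve (RKdVCH.flow a (RKdVCH.laxB b c n)) f)) := by
  refine ⟨RKdVCH.existsUnique_isSeriesB a, RKdVCH.exists_isSeriesC_iff a,
    fun c c' hc hc' => hc.eq_or_eq_neg hc', fun b c hb => ⟨fun n hc => ?_, fun n m hc f => ?_⟩⟩
  · exact RKdVCH.lambdaSum_flow hb n hc
  · exact RKdVCH.evolve_flow_comm hb n m hc f
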